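/- **Setting ($d=1$).** Let $(\Omega,\mathcal F,\mathbb P)$ be a probability space with a filtration $(\mathcal F_t)_{t\ge 0}$, and let $Z$ be a real standard Brownian motion with respect to $(\mathcal F_t)$. Let $T>0$, $\theta,\sigma\in\mathbb R$, let $F:[0,T]\to\mathbb R$ be continuous, and let $K,\mu:\mathbb R_+\to\mathbb R$ be deterministic functions such that * $K\in L^2_{loc}(\mathbb R_+)$ and there is $\gamma\in(0,2]$ with $\int_0^h K(t)^2\,dt=O(h^\gamma)$ and $\int_0^{T'}(K(t+h)-K(t))^2\,dt=O(h^\gamma)$ as $h\downarrow 0$, for every $T'<\infty$; * $K\in L^p_{loc}(\mathbb R_+)$ and $\mu\in L^q_{loc}(\mathbb R_+)$ for some $p,q\in[1,\infty]$ with $1/p+1/q=1$. Write $(f\star g)(t)=\int_0^t f(s)g(t-s)\,ds$. Let $R_\theta$ be the resolvent of the second kind of $\theta K$, i.e. the (a.e. unique) $R_\theta\in L^1_{loc}(\mathbb R_+)$ with $(\theta K)\star R_\theta=R_\theta\star(\theta K)=\theta K-R_\theta$, and put $E_\theta=K-R_\theta\star K$. For $0\le a\le b\le u\le T$ let $$g(u)=F(u)-\int_0^u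 R_\theta(u-s)F(s)\,ds,\qquad H_u=\int_0^u E_\theta(u-s)\,\theta\mu(s)\,ds,$$ $$Y^{\sigma}_{a,b}(u)=\int_a^b E_\theta(u-s)\,\sigma\,dZ_s,\qquad Y_{a,b}(u)=Y^{1}_{a,b}(u),$$ where the stochastic integrals are Wiener integrals. Let $X$ be the fractional Ornstein–Uhlenbeck process on $[0,T]$: either $X$ is a continuous strong solution of $$X_t=F(t)+\int_0^t K(t-s)\theta(\mu(s)-X_s)\,ds+\int_0^t K(t-s)\sigma\,dZ_s ,\qquad 0\le t\le T$$ (the equation holding almost surely for each $t$, and $X$ being adapted to $(\mathcal F_t)$ up to null sets), or $X$ is given by the explicit expression $X_u=g(u)+H_u+Y^{\sigma}_{0,u}(u)$ almost surely for each $u\in[0,T]$. **Proposition (conditional moment generating function).** For every $w\in\mathbb R$ and all $0\le t\le u\le T$, the random variable $\exp(wX_u)$ is integrable and, almost surely, $$\mathbb E\big[\exp(wX_u)\,\big|\,\mathcal F_t\big]=\exp\Big[w\big(g(u)+H_u+\sigma Y_{0,t}(u)\big)+w^2e_t(u,\sigma)\Big],$$ where $$e_t(u,\sigma)=\frac12\,\sigma^2\int_t^u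 E_\theta(u-s)^2\,ds .$$ -/

import Mathlib

open MeasureTheory ProbabilityTheory Filter Asymptotics
open scoped NNReal ENNReal Topology

/-- `f` belongs to `L^p_loc(ℝ₊)`. Values at negative arguments play no role. -/
def LpLoc (f : ℝ → ℝ) (p : ℝ≥0∞) : Prop :=
  ∀ T : ℝ, MemLp f p (volume.restrict (Set.Icc 0 T))

/-- Convolution of functions on `ℝ₊`: `(f ⋆ g)(t) = ∫_0^t f(s) g(t-s) ds`. -/
noncomputable def volterraConv (f g : ℝ → ℝ) (t : ℝ) : ℝ :=
  ∫ s in (0 : ℝ)..t, f s * g (t - s)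

/-- Regularity assumption on the convolution kernel: `K ∈ L^2_loc(ℝ₊)` and there is `γ ∈ (0,2]` with
`∫_0^h K(t)^2 dt = O(h^γ)` and `∫_0^T (K(t+h) - K(t))^2 dt = O(h^γ)` for every `T < ∞`,
as `h` decreases to `0`. -/
structure KernelRegular (K : ℝ → ℝ) : Prop where
  sq_loc : LpLoc K 2
  modulus : ∃ γ : ℝ, 0 < γ ∧ γ ≤ 2 ∧
    (fun h : ℝ => ∫ t in (0 : ℝ)..h, K t ^ 2) =O[𝓝[>] 0] (fun h : ℝ => h ^ γ) ∧
    ∀ T : ℝ, 0 ≤ T →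
      (fun h : ℝ => ∫ t in (0 : ℝ)..T, (K (t + h) - K t) ^ 2) =O[𝓝[>] 0] (fun h : ℝ => h ^ γ)

/-- `R` is the resolvent (of the second kind) of the kernel `k`: `R ∈ L^1_loc(ℝ₊)` and
`k ⋆ R = R ⋆ k = k - R`, as an identity in `L^1_loc(ℝ₊)`. This determines `R` up to null sets. -/
structure IsResolvent (k R : ℝ → ℝ) : Prop where
  loc : LpLoc R 1
  left_eq : ∀ᵐ t : ℝ, 0 ≤ t → volterraConv k R t = k t - R t
  right_eq : ∀ᵐ t : ℝ, 0 ≤ t → volterraConv R k t = k t - R t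

/-- The kernel `E_θ = K - R_θ ⋆ K`. -/
noncomputable def kernelE (K R : ℝ → ℝ) (t : ℝ) : ℝ := K t - volterraConv R K t

/-- `Z` is a standard Brownian motion with respect to the filtration `ℱ`. -/
structure IsBrownianWrt {Ω : Type*} {mΩ : MeasurableSpace Ω} (Z : ℝ≥0 → Ω → ℝ)
    (ℱ : Filtration ℝ≥0 mΩ) (P : Measure Ω) : Prop where
  brownian : IsBrownianReal Z P
  adapted : ∀ t : ℝ≥0, Measurable[ℱ t] (Z t)
  indep : ∀ s t : ℝ≥0, s ≤ t →
    Indep (MeasurableSpace.comap (fun ω => Z t ω - Z s ω) inferInstance) (ℱ s) P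

/-- The step function `∑ c_i 1_{(a_i, b_i]}`, coded by a finitely supported family of coefficients
indexed by pairs `(a_i, b_i)` (pairs with `b_i ≤ a_i` contribute zero). -/
noncomputable def stepFun (φ : ℝ≥0 × ℝ≥0 →₀ ℝ) (s : ℝ) : ℝ :=
  φ.sum fun I c => c * (Set.Ioc (I.1 : ℝ) (I.2 : ℝ)).indicator (fun _ => (1 : ℝ)) s

/-- The elementary integral `∑ c_i (Z_{b_i} - Z_{a_i})` of the step function coded by `φ`. -/
noncomputable def stepIntegral {Ω : Type*} (Z : ℝ≥0 → Ω → ℝ) (φ : ℝ≥0 × ℝ≥0 →₀ ℝ) (ω : Ω) : ℝ :=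
  φ.sum fun I c => c * (Z (max I.1 I.2) ω - Z I.1 ω)

/-- `J` is a version of the Wiener integral `∫ f dZ`: it is the `L^2(P)` limit of the elementary
integrals of step functions that converge to `f` in `L^2`. -/
structure IsWienerIntegral {Ω : Type*} {mΩ : MeasurableSpace Ω} (P : Measure Ω)
    (Z : ℝ≥0 → Ω → ℝ) (f : ℝ → ℝ) (J : Ω → ℝ) : Prop where
  memLp_fun : MemLp f 2 volume
  memLp_integral : MemLp J 2 P
  exists_approx : ∃ φ : ℕ → (ℝ≥0 × ℝ≥0 →₀ ℝ),
    Tendsto (fun n => eLpNorm (fun s => f s - stepFun (φ n) s) 2 volume) atTop (𝓝 0) ∧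
    Tendsto (fun n => eLpNorm (fun ω => J ω - stepIntegral Z (φ n) ω) 2 P) atTop (𝓝 0)

open Classical in
/-- The Wiener integral `∫_a^b f(s) dZ_s` for `0 ≤ a ≤ b` and `f ∈ L^2(a,b)`: a version of the
`L^2` limit, unique up to null sets when `Z` is a Brownian motion. -/
noncomputable def wienerIntegral {Ω : Type*} {mΩ : MeasurableSpace Ω} (P : Measure Ω)
    (Z : ℝ≥0 → Ω → ℝ) (a b : ℝ) (f : ℝ → ℝ) : Ω → ℝ :=
  if h : ∃ J, IsWienerIntegral P Z ((Set.Ioc a b).indicator f) J then h.choose else 0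

/-- The Gaussian Volterra process `Y^σ_{a,b}(u) = ∫_a^b E_θ(u-s) σ dZ_s`, with `E = E_θ`. -/
noncomputable def processY {Ω : Type*} {mΩ : MeasurableSpace Ω} (P : Measure Ω)
    (Z : ℝ≥0 → Ω → ℝ) (E : ℝ → ℝ) (σ a b u : ℝ) : Ω → ℝ :=
  wienerIntegral P Z a b (fun s => E (u - s) * σ)

/-- The deterministic function `H_{a,b}(u) = ∫_a^b E_θ(u-s) θ μ(s) ds`, with `E = E_θ`. -/
noncomputable def funH (E μ : ℝ → ℝ) (θ a b u : ℝ) : ℝ :=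
  ∫ s in a..b, E (u - s) * θ * μ s

/-- `g(u) = F(u) - ∫_0^u R_θ(u-s) F(s) ds`. -/
noncomputable def funG (F R : ℝ → ℝ) (u : ℝ) : ℝ :=
  F u - ∫ s in (0 : ℝ)..u, R (u - s) * F s

/-- `e_t(u,σ) = ½ σ² ∫_t^u E_θ(u-s)² ds`, with `E = E_θ`. -/
noncomputable def funE (E : ℝ → ℝ) (σ t u : ℝ) : ℝ :=
  1 / 2 * σ ^ 2 * ∫ s in t..u, E (u - s) ^ 2

/-- `X` is a continuous strong solution on `[0,T]` of the affine Volterra equation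
`X_t = F(t) + ∫_0^t K(t-s) θ (μ(s) - X_s) ds + ∫_0^t K(t-s) σ dZ_s`.
Adaptedness is understood up to null sets. -/
structure IsFOUSolution {Ω : Type*} {mΩ : MeasurableSpace Ω} (P : Measure Ω)
    (ℱ : Filtration ℝ≥0 mΩ) (Z : ℝ≥0 → Ω → ℝ) (K μ F : ℝ → ℝ) (θ σ T : ℝ)
    (X : ℝ≥0 → Ω → ℝ) : Prop where
  adapted : ∀ t : ℝ≥0, (t : ℝ) ≤ T → AEStronglyMeasurable[ℱ t] (X t) P
  continuous : ∀ᵐ ω ∂P, ContinuousOn (fun t : ℝ≥0 => X t ω) {t : ℝ≥0 | (t : ℝ) ≤ T}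
  equation : ∀ t : ℝ≥0, (t : ℝ) ≤ T → ∀ᵐ ω ∂P,
    X t ω = F t + (∫ s in (0 : ℝ)..t, K (t - s) * (θ * (μ s - X s.toNNReal ω)))
      + wienerIntegral P Z 0 t (fun s => K (t - s) * σ) ω

/-- `X` is given on `[0,T]` by the explicit expression `X_u = g(u) + H_u + Y^σ_u`, where
`H_u = H_{0,u}(u)` and `Y^σ_u = Y^σ_{0,u}(u)`, almost surely for each `u`. -/
def IsFOUExplicit {Ω : Type*} {mΩ : MeasurableSpace Ω} (P : Measure Ω)
    (Z : ℝ≥0 → Ω → ℝ) (K μ F R : ℝ → ℝ) (θ σ T : ℝ) (X : ℝ≥0 → Ω → ℝ) : Prop :=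
  ∀ u : ℝ≥0, (u : ℝ) ≤ T → ∀ᵐ ω ∂P,
    X u ω = funG F R u + funH (kernelE K R) μ θ 0 u u + processY P Z (kernelE K R) σ 0 u u ω

/-! The proof has two halves. The first is the explicit formula for `X`. Write k = θK and M for the
stochastic convolution of K with σ dZ, so that a solution satisfies x = F + k⋆μ − k⋆x + M.
Convolving with R and using R⋆(k⋆m) = k⋆m − R⋆m (`realConv_resolvent`) for m = μ and m = x cancels
R⋆x and expresses k⋆x through the data. What remains is x = (F − R⋆F) + R⋆μ + (M − R⋆M). Since θE_θ
= R almost everywhere, R⋆μ is H. The stochastic Fubini theorem `IsWienerIntegral.integral_mixture`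
identifies M − R⋆M with the Wiener integral of σE_θ(u − ·). This is `IsFOUSolution.isFOUExplicit`.

The second half splits that Wiener integral at t. The part over (0,t] is ℱ_t-measurable up to null
sets. The part over (t,u] is independent of ℱ_t (`IsWienerIntegral.indep`) and centred Gaussian with
variance σ²∫_t^u E_θ(u−s)² ds (`IsWienerIntegral.map_eq`). Hence it contributes its moment
generating function as a constant factor (`condExp_exp_mul_add_wienerIntegral`).

All facts about Wiener integrals come from the Itô isometry on step functions, carried through L²
limits. -/

/-! ### Step functions, elementary integrals and the isometry between them. -/

section StepFunctions

variable {Ω : Type*} {mΩ : MeasurableSpace Ω} {P : Measure Ω} {Z : ℝ≥0 → Ω → ℝ}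

lemma stepFun_add (φ ψ : ℝ≥0 × ℝ≥0 →₀ ℝ) (s : ℝ) :
    stepFun (φ + ψ) s = stepFun φ s + stepFun ψ s := by
  unfold stepFun
  exact Finsupp.sum_add_index' (by simp) (by intros; ring)

lemma stepFun_smul (c : ℝ) (φ : ℝ≥0 × ℝ≥0 →₀ ℝ) (s : ℝ) :
    stepFun (c • φ) s = c * stepFun φ s := by
  unfold stepFun
  rw [Finsupp.sum_smul_index (by simp), Finsupp.mul_sum]
  simp only [mul_assoc]

lemma stepIntegral_add (φ ψ : ℝ≥0 × ℝ≥0 →₀ ℝ) (ω : Ω) :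
    stepIntegral Z (φ + ψ) ω = stepIntegral Z φ ω + stepIntegral Z ψ ω := by
  unfold stepIntegral
  exact Finsupp.sum_add_index' (by simp) (by intros; ring)

lemma stepIntegral_smul (c : ℝ) (φ : ℝ≥0 × ℝ≥0 →₀ ℝ) (ω : Ω) :
    stepIntegral Z (c • φ) ω = c * stepIntegral Z φ ω := by
  unfold stepIntegral
  rw [Finsupp.sum_smul_index (by simp), Finsupp.mul_sum]
  simp only [mul_assoc]

lemma memLp_indicator_Ioc_one (a b : ℝ) (p : ℝ≥0∞) :
    MemLp ((Set.Ioc a b).indicator fun _ => (1 : ℝ)) p volume :=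
  memLp_indicator_const p measurableSet_Ioc 1 (Or.inr (by simp))

lemma memLp_stepFun (φ : ℝ≥0 × ℝ≥0 →₀ ℝ) (p : ℝ≥0∞) : MemLp (stepFun φ) p volume := by
  unfold stepFun Finsupp.sum
  exact memLp_finsetSum _ fun I _ => (memLp_indicator_Ioc_one _ _ p).const_mul _

lemma ProbabilityTheory.IsPreBrownianReal.memLp_eval (hZ : IsPreBrownianReal Z P) (t : ℝ≥0) :
    MemLp (Z t) 2 P :=
  (hZ.isGaussianProcess.hasGaussianLaw_eval t).memLp_two

lemma ProbabilityTheory.IsPreBrownianReal.memLp_stepIntegral (hZ : IsPreBrownianReal Z P)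
    (φ : ℝ≥0 × ℝ≥0 →₀ ℝ) : MemLp (stepIntegral Z φ) 2 P := by
  unfold stepIntegral Finsupp.sum
  exact memLp_finsetSum _ fun I _ => ((hZ.memLp_eval _).sub (hZ.memLp_eval _)).const_mul _

lemma ProbabilityTheory.IsPreBrownianReal.integral_eval_mul_eval (hZ : IsPreBrownianReal Z P)
    (s t : ℝ≥0) : ∫ ω, Z s ω * Z t ω ∂P = min (s : ℝ) t := by
  have := hZ.isGaussianProcess.isProbabilityMeasure
  have h := hZ.covariance_eval s t
  rw [covariance_eq_sub (hZ.memLp_eval s) (hZ.memLp_eval t), hZ.integral_eval] at h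
  simpa using h

lemma integral_indicator_Ioc_mul_indicator_Ioc (a b c d : ℝ) :
    ∫ s, (Set.Ioc a b).indicator (fun _ => (1 : ℝ)) s * (Set.Ioc c d).indicator (fun _ => 1) s
      = max (min b d - max a c) 0 := by
  have h : (fun s => (Set.Ioc a b).indicator (fun _ => (1 : ℝ)) s *
      (Set.Ioc c d).indicator (fun _ => 1) s)
      = (Set.Ioc (max a c) (min b d)).indicator fun _ => 1 := by
    ext s
    rw [← Set.Ioc_inter_Ioc, ← Set.indicator_indicator]
    by_cases h : s ∈ Set.Ioc a b <;> simp [h]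
  rw [h, integral_indicator_const _ measurableSet_Ioc]
  simp [Measure.real, ENNReal.toReal_ofReal']

/-- The Itô isometry on indicators: expanding with E[Z_s Z_t] = min(s,t) leaves the length of the
overlap of the two intervals. -/
lemma ProbabilityTheory.IsPreBrownianReal.integral_increment_mul_increment
    (hZ : IsPreBrownianReal Z P) (a b c d : ℝ≥0) :
    ∫ ω, (Z (max a b) ω - Z a ω) * (Z (max c d) ω - Z c ω) ∂P
      = ∫ s, (Set.Ioc (a : ℝ) b).indicator (fun _ => (1 : ℝ)) s *
          (Set.Ioc (c : ℝ) d).indicator (fun _ => 1) s := by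
  have hi (s t : ℝ≥0) : Integrable (fun ω => Z s ω * Z t ω) P :=
    (hZ.memLp_eval s).integrable_mul (hZ.memLp_eval t)
  have h : ∀ ω, (Z (max a b) ω - Z a ω) * (Z (max c d) ω - Z c ω) =
      (Z (max a b) ω * Z (max c d) ω - Z (max a b) ω * Z c ω)
        - (Z a ω * Z (max c d) ω - Z a ω * Z c ω) := fun ω => by ring
  have hi' (s t r : ℝ≥0) : Integrable (fun ω => Z s ω * Z t ω - Z s ω * Z r ω) P :=
    (hi s t).sub (hi s r)
  simp_rw [h]
  rw [integral_sub (hi' _ _ _) (hi' _ _ _), integral_sub (hi _ _) (hi _ _),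
    integral_sub (hi _ _) (hi _ _), integral_indicator_Ioc_mul_indicator_Ioc]
  simp only [hZ.integral_eval_mul_eval, NNReal.coe_max]
  grind

lemma ProbabilityTheory.IsPreBrownianReal.integral_stepIntegral_sq (hZ : IsPreBrownianReal Z P)
    (φ : ℝ≥0 × ℝ≥0 →₀ ℝ) :
    ∫ ω, stepIntegral Z φ ω ^ 2 ∂P = ∫ s, stepFun φ s ^ 2 := by
  unfold stepIntegral stepFun Finsupp.sum
  simp_rw [sq, Finset.sum_mul_sum]
  have hm (I : ℝ≥0 × ℝ≥0) : MemLp (fun ω => φ I * (Z (max I.1 I.2) ω - Z I.1 ω)) 2 P :=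
    ((hZ.memLp_eval _).sub (hZ.memLp_eval _)).const_mul _
  have hm' (I : ℝ≥0 × ℝ≥0) :
      MemLp (fun s => φ I * (Set.Ioc (I.1 : ℝ) I.2).indicator (fun _ => (1 : ℝ)) s) 2 volume :=
    (memLp_indicator_Ioc_one _ _ 2).const_mul _
  have hi (I J : ℝ≥0 × ℝ≥0) : Integrable (fun ω => φ I * (Z (max I.1 I.2) ω - Z I.1 ω) *
      (φ J * (Z (max J.1 J.2) ω - Z J.1 ω))) P := (hm I).integrable_mul (hm J)
  have hi' (I J : ℝ≥0 × ℝ≥0) :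
      Integrable (fun s => φ I * (Set.Ioc (I.1 : ℝ) I.2).indicator (fun _ => (1 : ℝ)) s *
        (φ J * (Set.Ioc (J.1 : ℝ) J.2).indicator (fun _ => (1 : ℝ)) s)) volume :=
    (hm' I).integrable_mul (hm' J)
  rw [integral_finsetSum _ fun I _ => integrable_finsetSum _ fun J _ => hi I J,
    integral_finsetSum _ fun I _ => integrable_finsetSum _ fun J _ => hi' I J]
  refine Finset.sum_congr rfl fun I _ => ?_
  rw [integral_finsetSum _ fun J _ => hi I J, integral_finsetSum _ fun J _ => hi' I J]
  refine Finset.sum_congr rfl fun J _ => ?_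
  simp only [fun x y : ℝ => (by ring : φ I * x * (φ J * y) = (φ I * φ J) * (x * y))]
  rw [integral_const_mul, integral_const_mul, hZ.integral_increment_mul_increment]

lemma eLpNorm_two_eq_ofReal_sqrt {α : Type*} {mα : MeasurableSpace α} {ν : Measure α} {f : α → ℝ}
    (hf : MemLp f 2 ν) : eLpNorm f 2 ν = ENNReal.ofReal (Real.sqrt (∫ x, f x ^ 2 ∂ν)) := by
  rw [hf.eLpNorm_eq_integral_rpow_norm (by simp) (by simp), Real.sqrt_eq_rpow]
  simp

lemma ProbabilityTheory.IsPreBrownianReal.eLpNorm_stepIntegral (hZ : IsPreBrownianReal Z P)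
    (φ : ℝ≥0 × ℝ≥0 →₀ ℝ) :
    eLpNorm (stepIntegral Z φ) 2 P = eLpNorm (stepFun φ) 2 volume := by
  rw [eLpNorm_two_eq_ofReal_sqrt (hZ.memLp_stepIntegral φ),
    eLpNorm_two_eq_ofReal_sqrt (memLp_stepFun φ 2), hZ.integral_stepIntegral_sq]

/-- The step function with the coefficients of `φ`, cut off outside `(s, t]`. -/
noncomputable def stepRestrict (s t : ℝ≥0) (φ : ℝ≥0 × ℝ≥0 →₀ ℝ) : ℝ≥0 × ℝ≥0 →₀ ℝ :=
  φ.mapDomain fun I => (max I.1 s, min I.2 t)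

lemma stepFun_stepRestrict (s t : ℝ≥0) (φ : ℝ≥0 × ℝ≥0 →₀ ℝ) :
    stepFun (stepRestrict s t φ) = (Set.Ioc (s : ℝ) t).indicator (stepFun φ) := by
  ext x
  unfold stepRestrict
  conv_lhs => unfold stepFun
  rw [Finsupp.sum_mapDomain_index (by simp) (by intros; ring)]
  simp only [NNReal.coe_max, NNReal.coe_min, ← Set.Ioc_inter_Ioc]
  by_cases hx : x ∈ Set.Ioc (s : ℝ) t
  · rw [Set.indicator_of_mem hx]
    unfold stepFun
    congr; ext I c
    rw [Set.inter_comm, ← Set.indicator_indicator, Set.indicator_of_mem hx]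
  · rw [Set.indicator_of_notMem hx]
    simp [Set.indicator, hx, Finsupp.sum]

lemma stepIntegral_stepRestrict (s t : ℝ≥0) (φ : ℝ≥0 × ℝ≥0 →₀ ℝ) (ω : Ω) :
    stepIntegral Z (stepRestrict s t φ) ω
      = φ.sum fun I c => c * (Z (max (max I.1 s) (min I.2 t)) ω - Z (max I.1 s) ω) := by
  unfold stepIntegral stepRestrict
  rw [Finsupp.sum_mapDomain_index (by simp) (by intros; ring)]

/-- Step functions are dense in `L^2(0, ∞)`. -/
lemma exists_tendsto_stepFun {f : ℝ → ℝ} (hf : MemLp f 2 volume)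
    (hf0 : ∀ᵐ s : ℝ, s ≤ 0 → f s = 0) :
    ∃ φ : ℕ → (ℝ≥0 × ℝ≥0 →₀ ℝ),
      Tendsto (fun n => eLpNorm (fun s => f s - stepFun (φ n) s) 2 volume) atTop (𝓝 0) := by
  let A : (ℝ≥0 × ℝ≥0 →₀ ℝ) →ₗ[ℝ] Lp ℝ 2 (volume : Measure ℝ) :=
    { toFun := fun φ => (memLp_stepFun φ 2).toLp _
      map_add' := fun φ ψ => by
        rw [← MemLp.toLp_add]; congr 1; ext s; exact stepFun_add φ ψ s
      map_smul' := fun c φ => by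
        rw [RingHom.id_apply, ← MemLp.toLp_const_smul]; congr 1; ext s; exact stepFun_smul c φ s }
  have hA (φ) : A φ = (memLp_stepFun φ 2).toLp _ := rfl
  have hmem : hf.toLp f ∈ (LinearMap.range A).topologicalClosure := by
    -- If g is orthogonal to every step function, its primitive from 0 vanishes on (0,∞), so g = 0
    -- there by Lebesgue differentiation. As f vanishes on the other half-line, f is orthogonal to
    -- g.
    rw [← Submodule.orthogonal_orthogonal_eq_closure, Submodule.mem_orthogonal]
    intro g hg
    have hgint (a b : ℝ≥0) : ∫ s in Set.Ioc (a : ℝ) b, g s = 0 := by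
      have h := (Submodule.mem_orthogonal _ _).1 hg (A (Finsupp.single (a, b) 1)) ⟨_, rfl⟩
      rw [L2.inner_def, hA] at h
      rw [← h, ← integral_indicator measurableSet_Ioc]
      refine integral_congr_ae ?_
      filter_upwards [(memLp_stepFun (Finsupp.single (a, b) 1) 2).coeFn_toLp] with s hs
      rw [hs]
      by_cases h : s ∈ Set.Ioc (a : ℝ) b <;> simp [stepFun, h]
    have hgloc : LocallyIntegrable (g : ℝ → ℝ) volume :=
      (Lp.memLp g).locallyIntegrable (by norm_num)
    have hg0 : ∀ᵐ s : ℝ, 0 < s → g s = 0 := by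
      filter_upwards [LocallyIntegrable.ae_hasDerivAt_integral hgloc] with s hs hpos
      have h1 := hs 0
      have h2 : (fun x => ∫ y in (0 : ℝ)..x, g y) =ᶠ[𝓝 s] fun _ => 0 := by
        filter_upwards [lt_mem_nhds hpos] with x hx
        rw [intervalIntegral.integral_of_le hx.le]
        have h := hgint 0 ⟨x, hx.le⟩
        rwa [NNReal.coe_zero] at h
      exact (h1.congr_of_eventuallyEq h2.symm).unique (hasDerivAt_const s 0)
    rw [L2.inner_def]
    refine integral_eq_zero_of_ae ?_
    filter_upwards [hf.coeFn_toLp, hg0, hf0] with s h1 h2 h3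
    rcases le_or_gt s 0 with h | h
    · simp [h1, h3 h]
    · simp [h2 h]
  rw [← SetLike.mem_coe, Submodule.topologicalClosure_coe, mem_closure_iff_seq_limit] at hmem
  obtain ⟨x, hx, hlim⟩ := hmem
  choose φ hφ using hx
  refine ⟨φ, ?_⟩
  have h := (Lp.tendsto_Lp_iff_tendsto_eLpNorm' x _).1 hlim
  refine h.congr fun n => ?_
  rw [eLpNorm_sub_comm]
  refine eLpNorm_congr_ae ?_
  rw [← hφ n, hA]
  filter_upwards [hf.coeFn_toLp, (memLp_stepFun (φ n) 2).coeFn_toLp] with s h1 h2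
  simp [h1, h2]

end StepFunctions

/-! ### The Wiener integral: isometry, uniqueness, existence, law and measurability. -/

section WienerIntegral

variable {Ω : Type*} {mΩ : MeasurableSpace Ω} {P : Measure Ω} {Z : ℝ≥0 → Ω → ℝ}

lemma tendsto_eLpNorm_of_tendsto_eLpNorm_sub {α : Type*} {mα : MeasurableSpace α} {ν : Measure α}
    {f : α → ℝ} {g : ℕ → α → ℝ} (hf : MemLp f 2 ν) (hg : ∀ n, MemLp (g n) 2 ν)
    (h : Tendsto (fun n => eLpNorm (fun x => f x - g n x) 2 ν) atTop (𝓝 0)) :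
    Tendsto (fun n => eLpNorm (g n) 2 ν) atTop (𝓝 (eLpNorm f 2 ν)) := by
  have h1 := (Lp.tendsto_Lp_iff_tendsto_eLpNorm'' g hg f hf).2
    (h.congr fun n => by rw [eLpNorm_sub_comm]; rfl)
  simpa only [Lp.enorm_toLp] using h1.enorm

/-- The isometry survives L² limits because the norm is continuous on both sides. -/
lemma IsWienerIntegral.eLpNorm_eq (hZ : IsPreBrownianReal Z P) {f : ℝ → ℝ} {J : Ω → ℝ}
    (h : IsWienerIntegral P Z f J) : eLpNorm J 2 P = eLpNorm f 2 volume := by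
  obtain ⟨φ, h1, h2⟩ := h.exists_approx
  refine tendsto_nhds_unique (tendsto_eLpNorm_of_tendsto_eLpNorm_sub h.memLp_integral
    (fun n => hZ.memLp_stepIntegral (φ n)) h2) ?_
  simp_rw [hZ.eLpNorm_stepIntegral]
  exact tendsto_eLpNorm_of_tendsto_eLpNorm_sub h.memLp_fun (fun n => memLp_stepFun (φ n) 2) h1

lemma IsWienerIntegral.integral_sq (hZ : IsPreBrownianReal Z P) {f : ℝ → ℝ} {J : Ω → ℝ}
    (h : IsWienerIntegral P Z f J) : ∫ ω, J ω ^ 2 ∂P = ∫ s, f s ^ 2 := by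
  have h1 := h.eLpNorm_eq hZ
  rw [eLpNorm_two_eq_ofReal_sqrt h.memLp_integral, eLpNorm_two_eq_ofReal_sqrt h.memLp_fun,
    ENNReal.ofReal_eq_ofReal_iff (Real.sqrt_nonneg _) (Real.sqrt_nonneg _),
    Real.sqrt_inj (integral_nonneg fun _ => sq_nonneg _) (integral_nonneg fun _ => sq_nonneg _)]
    at h1
  exact h1

lemma IsWienerIntegral.congr {f g : ℝ → ℝ} {J I : Ω → ℝ} (h : IsWienerIntegral P Z f J)
    (hfg : f =ᵐ[volume] g) (hJI : J =ᵐ[P] I) : IsWienerIntegral P Z g I where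
  memLp_fun := (memLp_congr_ae hfg).1 h.memLp_fun
  memLp_integral := (memLp_congr_ae hJI).1 h.memLp_integral
  exists_approx := by
    obtain ⟨φ, h1, h2⟩ := h.exists_approx
    refine ⟨φ, h1.congr fun n => eLpNorm_congr_ae ?_, h2.congr fun n => eLpNorm_congr_ae ?_⟩
    · filter_upwards [hfg] with s hs using by rw [hs]
    · filter_upwards [hJI] with s hs using by rw [hs]

lemma tendsto_eLpNorm_const_mul {α : Type*} {mα : MeasurableSpace α} {ν : Measure α}
    {g : ℕ → α → ℝ} (h : Tendsto (fun n => eLpNorm (g n) 2 ν) atTop (𝓝 0)) (c : ℝ) :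
    Tendsto (fun n => eLpNorm (fun x => c * g n x) 2 ν) atTop (𝓝 0) := by
  have h3 := ENNReal.Tendsto.const_mul (a := ‖c‖ₑ) h (Or.inr (by simp))
  rw [mul_zero] at h3
  refine h3.congr fun n => ?_
  exact (eLpNorm_const_smul c (g n) 2 ν).symm

lemma IsWienerIntegral.const_mul {f : ℝ → ℝ} {J : Ω → ℝ} (h : IsWienerIntegral P Z f J) (c : ℝ) :
    IsWienerIntegral P Z (fun s => c * f s) (fun ω => c * J ω) where
  memLp_fun := h.memLp_fun.const_mul c
  memLp_integral := h.memLp_integral.const_mul c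
  exists_approx := by
    obtain ⟨φ, h1, h2⟩ := h.exists_approx
    refine ⟨fun n => c • φ n, ?_, ?_⟩
    · simp_rw [stepFun_smul, ← mul_sub]
      exact tendsto_eLpNorm_const_mul h1 c
    · simp_rw [stepIntegral_smul, ← mul_sub]
      exact tendsto_eLpNorm_const_mul h2 c

lemma IsWienerIntegral.add (hZ : IsPreBrownianReal Z P) {f g : ℝ → ℝ} {J I : Ω → ℝ}
    (h : IsWienerIntegral P Z f J)
    (h' : IsWienerIntegral P Z g I) :
    IsWienerIntegral P Z (fun s => f s + g s) (fun ω => J ω + I ω) where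
  memLp_fun := h.memLp_fun.add h'.memLp_fun
  memLp_integral := h.memLp_integral.add h'.memLp_integral
  exists_approx := by
    obtain ⟨φ, h1, h2⟩ := h.exists_approx
    obtain ⟨ψ, h3, h4⟩ := h'.exists_approx
    refine ⟨fun n => φ n + ψ n, ?_, ?_⟩
    · simp_rw [stepFun_add, add_sub_add_comm]
      have h5 := h1.add h3
      rw [add_zero] at h5
      exact tendsto_of_tendsto_of_tendsto_of_le_of_le tendsto_const_nhds h5 (fun _ => zero_le)
        fun n => eLpNorm_add_le (h.memLp_fun.sub (memLp_stepFun (φ n) 2)).1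
          (h'.memLp_fun.sub (memLp_stepFun (ψ n) 2)).1 (by norm_num)
    · simp_rw [stepIntegral_add, add_sub_add_comm]
      have h5 := h2.add h4
      rw [add_zero] at h5
      exact tendsto_of_tendsto_of_tendsto_of_le_of_le tendsto_const_nhds h5 (fun _ => zero_le)
        fun n => eLpNorm_add_le (h.memLp_integral.sub (hZ.memLp_stepIntegral (φ n))).1
          (h'.memLp_integral.sub (hZ.memLp_stepIntegral (ψ n))).1 (by norm_num)

lemma IsWienerIntegral.sub (hZ : IsPreBrownianReal Z P) {f g : ℝ → ℝ} {J I : Ω → ℝ}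
    (h : IsWienerIntegral P Z f J) (h' : IsWienerIntegral P Z g I) :
    IsWienerIntegral P Z (fun s => f s - g s) (fun ω => J ω - I ω) := by
  simpa [sub_eq_add_neg] using h.add hZ (h'.const_mul (-1))

lemma ae_eq_of_integral_sub_sq_eq_zero {J I : Ω → ℝ} (hJ : MemLp J 2 P) (hI : MemLp I 2 P)
    (h : ∫ ω, (J ω - I ω) ^ 2 ∂P = 0) : J =ᵐ[P] I := by
  have h := (integral_eq_zero_iff_of_nonneg (fun _ => sq_nonneg _) (hJ.sub hI).integrable_sq).1 h
  filter_upwards [h] with ω hω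
  exact sub_eq_zero.1 (pow_eq_zero_iff two_ne_zero |>.1 hω)

/-- The difference is a Wiener integral of 0, so the isometry makes its norm zero. Thus the choice
made in `wienerIntegral` is immaterial. -/
lemma IsWienerIntegral.ae_eq (hZ : IsPreBrownianReal Z P) {f : ℝ → ℝ} {J I : Ω → ℝ}
    (h : IsWienerIntegral P Z f J) (h' : IsWienerIntegral P Z f I) : J =ᵐ[P] I := by
  refine ae_eq_of_integral_sub_sq_eq_zero h.memLp_integral h'.memLp_integral ?_
  simpa using (h.sub hZ h').integral_sq hZ

lemma integral_add_sq {α : Type*} {mα : MeasurableSpace α} {ν : Measure α} {a b : α → ℝ}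
  (ha : MemLp a 2 ν) (hb : MemLp b 2 ν) :
  ∫ x, (a x + b x) ^ 2 ∂ν
      = ∫ x, a x ^ 2 ∂ν + 2 * ∫ x, a x * b x ∂ν + ∫ x, b x ^ 2 ∂ν := by
  have hab : Integrable (fun x => a x * b x) ν := ha.integrable_mul hb
  have h1 : Integrable (fun x => a x ^ 2 + 2 * (a x * b x)) ν :=
    ha.integrable_sq.add (hab.const_mul 2)
  rw [← integral_const_mul, ← integral_add ha.integrable_sq (hab.const_mul 2),
    ← integral_add h1 hb.integrable_sq]
  exact integral_congr_ae (ae_of_all _ fun x => by ring)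

lemma IsWienerIntegral.integral_mul (hZ : IsPreBrownianReal Z P) {f g : ℝ → ℝ} {J I : Ω → ℝ}
    (h : IsWienerIntegral P Z f J) (h' : IsWienerIntegral P Z g I) :
    ∫ ω, J ω * I ω ∂P = ∫ s, f s * g s := by
  have h1 := (h.add hZ h').integral_sq hZ
  rw [integral_add_sq h.memLp_integral h'.memLp_integral, h.integral_sq hZ, h'.integral_sq hZ] at h1
  have h2 := integral_add_sq h.memLp_fun h'.memLp_fun
  linarith

lemma exists_isWienerIntegral (hZ : IsPreBrownianReal Z P) {f : ℝ → ℝ}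
    (hf : MemLp f 2 volume) (hf0 : ∀ᵐ s : ℝ, s ≤ 0 → f s = 0) :
    ∃ J, IsWienerIntegral P Z f J := by
  obtain ⟨φ, hφ⟩ := exists_tendsto_stepFun hf hf0
  let A (n : ℕ) : Lp ℝ 2 (volume : Measure ℝ) := (memLp_stepFun (φ n) 2).toLp _
  let B (n : ℕ) : Lp ℝ 2 P := (hZ.memLp_stepIntegral (φ n)).toLp _
  have hA : Tendsto A atTop (𝓝 (hf.toLp f)) :=
    (Lp.tendsto_Lp_iff_tendsto_eLpNorm'' _ (fun n => memLp_stepFun (φ n) 2) f hf).2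
      (hφ.congr fun n => by rw [eLpNorm_sub_comm]; rfl)
  -- By linearity and the isometry, the elementary integrals are Cauchy because the step functions
  -- are.
  have hAB (n m : ℕ) : edist (B n) (B m) = edist (A n) (A m) := by
    simp only [A, B, Lp.edist_toLp_toLp]
    have h1 := hZ.eLpNorm_stepIntegral (φ n + (-1 : ℝ) • φ m)
    have h2 : stepIntegral Z (φ n + (-1 : ℝ) • φ m)
        = stepIntegral Z (φ n) - stepIntegral Z (φ m) := by
      ext ω; rw [stepIntegral_add, stepIntegral_smul, Pi.sub_apply]; ring
    have h3 : stepFun (φ n + (-1 : ℝ) • φ m) = stepFun (φ n) - stepFun (φ m) := by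
      ext s; rw [stepFun_add, stepFun_smul, Pi.sub_apply]; ring
    rwa [h2, h3] at h1
  have hB : CauchySeq B := by
    have h := hA.cauchySeq
    rw [EMetric.cauchySeq_iff] at h ⊢
    simpa only [hAB] using h
  obtain ⟨J, hJ⟩ := cauchySeq_tendsto_of_complete hB
  refine ⟨J, hf, Lp.memLp J, φ, hφ, ?_⟩
  refine ((Lp.tendsto_Lp_iff_tendsto_eLpNorm' B J).1 hJ).congr fun n => ?_
  rw [eLpNorm_sub_comm]
  refine eLpNorm_congr_ae ?_
  filter_upwards [(hZ.memLp_stepIntegral (φ n)).coeFn_toLp] with ω hω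
  simp [B, hω]

/-- The approximating step functions can be cut off where the integrand vanishes and chosen so that
their elementary integrals converge almost surely. -/
lemma IsWienerIntegral.exists_tendsto_ae (hZ : IsPreBrownianReal Z P) {f : ℝ → ℝ}
    {J : Ω → ℝ} {s t : ℝ≥0} (h : IsWienerIntegral P Z ((Set.Ioc (s : ℝ) t).indicator f) J) :
    ∃ φ : ℕ → (ℝ≥0 × ℝ≥0 →₀ ℝ),
      Tendsto (fun n => eLpNorm (fun x => (Set.Ioc (s : ℝ) t).indicator f x
        - stepFun (stepRestrict s t (φ n)) x) 2 volume) atTop (𝓝 0) ∧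
      ∀ᵐ ω ∂P, Tendsto (fun n => stepIntegral Z (stepRestrict s t (φ n)) ω) atTop (𝓝 (J ω)) := by
  obtain ⟨φ, h1, -⟩ := h.exists_approx
  have h2 : Tendsto (fun n => eLpNorm (fun x => (Set.Ioc (s : ℝ) t).indicator f x
      - stepFun (stepRestrict s t (φ n)) x) 2 volume) atTop (𝓝 0) := by
    -- The target vanishes off (s,t], so truncation can only decrease the pointwise error.
    refine tendsto_of_tendsto_of_tendsto_of_le_of_le tendsto_const_nhds h1 (fun _ => zero_le)
      fun n => eLpNorm_mono fun x => ?_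
    rw [stepFun_stepRestrict]
    by_cases hx : x ∈ Set.Ioc (s : ℝ) t <;> simp [hx]
  have h3 : Tendsto (fun n => eLpNorm (stepIntegral Z (stepRestrict s t (φ n)) - J) 2 P)
      atTop (𝓝 0) := by
    refine h2.congr fun n => ?_
    have hstep : IsWienerIntegral P Z (stepFun (stepRestrict s t (φ n)))
        (stepIntegral Z (stepRestrict s t (φ n))) :=
      ⟨memLp_stepFun _ 2, hZ.memLp_stepIntegral _, fun _ => stepRestrict s t (φ n), by simp,
        by simp⟩
    rw [eLpNorm_sub_comm]
    exact ((h.sub hZ hstep).eLpNorm_eq hZ).symm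
  obtain ⟨ns, hns, hlim⟩ := (tendstoInMeasure_of_tendsto_eLpNorm (by norm_num)
    (fun n => (hZ.memLp_stepIntegral _).1) h.memLp_integral.1 h3).exists_seq_tendsto_ae
  exact ⟨fun n => φ (ns n), h2.comp hns.tendsto_atTop, hlim⟩

/-- Dominated convergence with bound 1. The measure Q is left general because the limit is taken
both under P and under P conditioned on an event. -/
lemma tendsto_charFun_map {Q : Measure Ω} [IsFiniteMeasure Q] {S : ℕ → Ω → ℝ} {J : Ω → ℝ}
    (hS : ∀ n, AEMeasurable (S n) Q) (hJ : AEMeasurable J Q)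
    (h : ∀ᵐ ω ∂Q, Tendsto (fun n => S n ω) atTop (𝓝 (J ω))) (x : ℝ) :
    Tendsto (fun n => charFun (Q.map (S n)) x) atTop (𝓝 (charFun (Q.map J) x)) := by
  have hmap {V : Ω → ℝ} (hV : AEMeasurable V Q) :
      charFun (Q.map V) x = ∫ ω, Complex.exp (x * V ω * Complex.I) ∂Q := by
    rw [charFun_apply_real, integral_map hV]
    exact Continuous.aestronglyMeasurable (by fun_prop)
  simp_rw [hmap hJ, hmap (hS _)]
  refine tendsto_integral_of_dominated_convergence (fun _ => (1 : ℝ)) (fun n => ?_)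
    (integrable_const 1) (fun n => ae_of_all _ fun ω => ?_) ?_
  · exact (Continuous.measurable (by fun_prop :
      Continuous fun v : ℝ => Complex.exp (x * v * Complex.I))).comp_aemeasurable (hS n)
        |>.aestronglyMeasurable
  · rw [← Complex.ofReal_mul, Complex.norm_exp_ofReal_mul_I]
  · filter_upwards [h] with ω hω
    exact ((by fun_prop : Continuous fun v : ℝ => Complex.exp (x * v * Complex.I)).tendsto _).comp
      hω

lemma ProbabilityTheory.IsPreBrownianReal.map_stepIntegral (hZ : IsPreBrownianReal Z P)
    (φ : ℝ≥0 × ℝ≥0 →₀ ℝ) :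
    P.map (stepIntegral Z φ) = gaussianReal 0 (∫ s, stepFun φ s ^ 2).toNNReal := by
  have := hZ.isGaussianProcess.isProbabilityMeasure
  have hproc : IsGaussianProcess
      (fun (I : ℝ≥0 × ℝ≥0) ω => φ I * (Z (max I.1 I.2) ω - Z I.1 ω)) P :=
    hZ.isGaussianProcess.of_isGaussianProcess fun I => by
      classical
      exact ⟨{max I.1 I.2, I.1}, φ I • (ContinuousLinearMap.proj ⟨max I.1 I.2, by simp⟩ -
        ContinuousLinearMap.proj ⟨I.1, by simp⟩), fun ω => by simp⟩
  have hlaw : HasGaussianLaw (stepIntegral Z φ) P := hproc.hasGaussianLaw_fun_sum (I := φ.support)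
  have hmean : ∫ ω, stepIntegral Z φ ω ∂P = 0 := by
    unfold stepIntegral Finsupp.sum
    have hi (I : ℝ≥0 × ℝ≥0) : Integrable (fun ω => φ I * (Z (max I.1 I.2) ω - Z I.1 ω)) P :=
      ((hZ.integrable_eval _).sub (hZ.integrable_eval _)).const_mul _
    rw [integral_finsetSum _ fun I _ => hi I]
    refine Finset.sum_eq_zero fun I _ => ?_
    rw [integral_const_mul, integral_sub (hZ.integrable_eval _) (hZ.integrable_eval _), hZ.integral_eval, hZ.integral_eval]
    simp
  rw [hlaw.map_eq_gaussianReal, hmean, variance_of_integral_eq_zero hlaw.aemeasurable hmean,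
    hZ.integral_stepIntegral_sq]

/-- The elementary integrals are centred Gaussian and their variances converge, so the
characteristic functions converge to the Gaussian one with the limiting variance. -/
lemma IsWienerIntegral.map_eq (hZ : IsPreBrownianReal Z P) {f : ℝ → ℝ} {J : Ω → ℝ} {s t : ℝ≥0}
    (h : IsWienerIntegral P Z ((Set.Ioc (s : ℝ) t).indicator f) J) :
    P.map J = gaussianReal 0 (∫ x in Set.Ioc (s : ℝ) t, f x ^ 2).toNNReal := by
  have := hZ.isGaussianProcess.isProbabilityMeasure
  obtain ⟨φ, h1, h2⟩ := h.exists_tendsto_ae hZ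
  have hlim (x : ℝ) := tendsto_charFun_map (fun n => (hZ.memLp_stepIntegral _).1.aemeasurable)
    h.memLp_integral.1.aemeasurable h2 x
  simp_rw [hZ.map_stepIntegral, charFun_gaussianReal] at hlim
  have h3 := tendsto_eLpNorm_of_tendsto_eLpNorm_sub h.memLp_fun (fun n => memLp_stepFun _ 2) h1
  have hsq {g : ℝ → ℝ} (hg : MemLp g 2 volume) :
      ∫ s, g s ^ 2 = (eLpNorm g 2 volume).toReal ^ 2 := by
    rw [eLpNorm_two_eq_ofReal_sqrt hg, ENNReal.toReal_ofReal (Real.sqrt_nonneg _),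
      Real.sq_sqrt (integral_nonneg fun _ => sq_nonneg _)]
  have h4 : Tendsto (fun n => ∫ x, stepFun (stepRestrict s t (φ n)) x ^ 2) atTop
      (𝓝 (∫ x in Set.Ioc (s : ℝ) t, f x ^ 2)) := by
    have h5 := ((ENNReal.tendsto_toReal h.memLp_fun.2.ne).comp h3).pow 2
    rw [← hsq h.memLp_fun] at h5
    have h6 : ∫ x, (Set.Ioc (s : ℝ) t).indicator f x ^ 2 = ∫ x in Set.Ioc (s : ℝ) t, f x ^ 2 := by
      rw [← integral_indicator measurableSet_Ioc]
      congr; ext x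
      by_cases hx : x ∈ Set.Ioc (s : ℝ) t <;> simp [hx]
    rw [h6] at h5
    exact h5.congr fun n => (hsq (memLp_stepFun _ 2)).symm
  refine Measure.ext_of_charFun (funext fun x => tendsto_nhds_unique (hlim x) ?_)
  rw [charFun_gaussianReal]
  have hc : Continuous fun v : ℝ≥0 => Complex.exp (x * ((0 : ℝ) : ℂ) * Complex.I
      - ((v : ℝ) : ℂ) * x ^ 2 / 2) := by fun_prop
  exact (hc.tendsto _).comp ((continuous_real_toNNReal.tendsto _).comp h4)

/-- An almost sure limit of `m`-measurable functions is almost surely `m`-measurable. -/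
lemma aestronglyMeasurable_sub_of_tendsto_ae {m : MeasurableSpace Ω} {S : ℕ → Ω → ℝ} {J : Ω → ℝ}
    (hS : ∀ n, Measurable[m] (S n))
    (h : ∀ᵐ ω ∂P, Tendsto (fun n => S n ω) atTop (𝓝 (J ω))) : AEStronglyMeasurable[m] J P := by
  refine ⟨fun ω => limUnder atTop fun n => S n ω,
    StronglyMeasurable.limUnder fun n => (hS n).stronglyMeasurable, ?_⟩
  filter_upwards [h] with ω hω using hω.limUnder_eq.symm

lemma IsWienerIntegral.aestronglyMeasurable {ℱ : Filtration ℝ≥0 mΩ} (hZ : IsBrownianWrt Z ℱ P)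
    {f : ℝ → ℝ} {J : Ω → ℝ} {s t : ℝ≥0}
    (h : IsWienerIntegral P Z ((Set.Ioc (s : ℝ) t).indicator f) J) :
    AEStronglyMeasurable[ℱ t] J P := by
  obtain ⟨φ, -, h2⟩ := h.exists_tendsto_ae hZ.brownian.toIsPreBrownianReal
  refine aestronglyMeasurable_sub_of_tendsto_ae (fun n => ?_) h2
  simp_rw [funext (stepIntegral_stepRestrict s t (φ n))]
  refine Finset.measurable_fun_sum _ fun I _ => Measurable.const_mul ?_ _
  rcases le_or_gt (max I.1 s) t with hI | hI
  · exact ((hZ.adapted _).mono (ℱ.mono (max_le hI (min_le_right _ _))) le_rfl).sub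
      ((hZ.adapted _).mono (ℱ.mono hI) le_rfl)
  -- The truncated interval is empty: both times equal max I.1 s, so the increment is 0 although
  -- that time exceeds t.
  · rw [max_eq_left ((min_le_right I.2 t).trans hI.le)]
    simp

end WienerIntegral

/-! ### Independence of the Wiener integral over (t,u] from the past. -/

section Independence

variable {Ω : Type*} {mΩ : MeasurableSpace Ω} {P : Measure Ω} {Z : ℝ≥0 → Ω → ℝ}
  {ℱ : Filtration ℝ≥0 mΩ}

lemma IsBrownianWrt.measurable (hZ : IsBrownianWrt Z ℱ P) (t : ℝ≥0) : Measurable (Z t) :=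
  (hZ.adapted t).mono (ℱ.le t) le_rfl

lemma IsBrownianWrt.measure_inter_increment (hZ : IsBrownianWrt Z ℱ P) {a b : ℝ≥0} (hab : a ≤ b)
    {A : Set Ω} (hA : MeasurableSet[ℱ a] A) {C : Set ℝ} (hC : MeasurableSet C) :
    P (A ∩ (fun ω => Z b ω - Z a ω) ⁻¹' C) = P A * P ((fun ω => Z b ω - Z a ω) ⁻¹' C) := by
  rw [Set.inter_comm, mul_comm]
  exact (Indep_iff _ _ _).1 (hZ.indep a b hab) _ _ ⟨C, hC, rfl⟩ hA

lemma IsBrownianWrt.cond_increment [IsProbabilityMeasure P] (hZ : IsBrownianWrt Z ℱ P)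
    {a b : ℝ≥0} (hab : a ≤ b)
    {A : Set Ω} (hA : MeasurableSet[ℱ a] A) (hA0 : P A ≠ 0) {C : Set ℝ} (hC : MeasurableSet C) :
    P[|A] ((fun ω => Z b ω - Z a ω) ⁻¹' C) = P ((fun ω => Z b ω - Z a ω) ⁻¹' C) := by
  rw [cond_apply (ℱ.le a _ hA), hZ.measure_inter_increment hab hA hC, ← mul_assoc,
    ENNReal.inv_mul_cancel hA0 (by simp), one_mul]

/-- Conditionally on an event of `ℱ t`, the increments of `Z` after `t` form a Brownian motion. -/
lemma IsBrownianWrt.isPreBrownianReal_cond [IsProbabilityMeasure P] (hZ : IsBrownianWrt Z ℱ P)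
    {t : ℝ≥0} {A : Set Ω} (hA : MeasurableSet[ℱ t] A) (hA0 : P A ≠ 0) :
    IsPreBrownianReal (fun s ω => Z (t + s) ω - Z t ω) P[|A] := by
  have hprob : IsProbabilityMeasure P[|A] := cond_isProbabilityMeasure hA0
  have hm (a b : ℝ≥0) : Measurable fun ω => Z b ω - Z a ω := (hZ.measurable b).sub (hZ.measurable a)
  refine HasIndepIncrements.isPreBrownianReal_of_hasLaw (fun s => ⟨(hm _ _).aemeasurable, ?_⟩)
    (HasIndepIncrements.of_nat fun τ hτ _ => ?_)
  · have hlaw := (hZ.brownian.toIsPreBrownianReal.hasLaw_sub (t + s) t).map_eq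
    have hs : nndist ((t + s : ℝ≥0) : ℝ) (t : ℝ) = s := by
      ext; simp
    rw [show nndist (t + s).1 t.1 = s from hs] at hlaw
    rw [← hlaw]
    ext C hC
    rw [Measure.map_apply (hm _ _) hC,
      Measure.map_apply ((hZ.measurable _).sub (hZ.measurable _)) hC]
    exact hZ.cond_increment le_self_add hA hA0 hC
  · simp only [sub_sub_sub_cancel_right]
    rw [iIndepFun_iff_measure_inter_preimage_eq_mul]
    intro S
    induction S using Finset.induction_on_max with
    | empty => simp
    | insert n S hS ih =>
      intro C hC
      have hn : n ∉ S := fun h => lt_irrefl _ (hS n h)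
      have hCn := hC n (Finset.mem_insert_self n S)
      have hCS := fun i hi => hC i (Finset.mem_insert_of_mem (b := n) hi)
      have hle : t + τ n ≤ t + τ (n + 1) := by gcongr; exact hτ n.le_succ
      -- The conditioning event and all earlier increments belong to the past of the last increment,
      -- which therefore factors off.
      have hAn : MeasurableSet[ℱ (t + τ n)] A := ℱ.mono le_self_add _ hA
      have hB : MeasurableSet[ℱ (t + τ n)]
          (⋂ i ∈ S, (fun ω => Z (t + τ (i + 1)) ω - Z (t + τ i) ω) ⁻¹' C i) := by
        refine Finset.measurableSet_biInter _ fun i hi => ?_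
        have h1 : t + τ (i + 1) ≤ t + τ n := by gcongr; exact hτ (hS i hi)
        have h2 : t + τ i ≤ t + τ n := by gcongr; exact hτ (hS i hi).le
        exact (((hZ.adapted _).mono (ℱ.mono h1) le_rfl).sub
          ((hZ.adapted _).mono (ℱ.mono h2) le_rfl)) (hCS i hi)
      rw [Finset.set_biInter_insert, Finset.prod_insert hn, ← ih hCS,
        hZ.cond_increment hle hAn hA0 hCn, cond_apply (ℱ.le t _ hA), cond_apply (ℱ.le t _ hA),
        Set.inter_comm _ (⋂ i ∈ S, _), ← Set.inter_assoc,
        hZ.measure_inter_increment hle (hAn.inter hB) hCn]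
      ring

/-- Re-expresses integrals over (t,u] through the process restarted at t, which is Brownian both
under P and under P conditioned on an event of ℱ_t. -/
lemma exists_stepIntegral_stepRestrict_eq_shift (t u : ℝ≥0) (φ : ℝ≥0 × ℝ≥0 →₀ ℝ) :
    ∃ ψ : ℝ≥0 × ℝ≥0 →₀ ℝ, ∀ ω, stepIntegral Z (stepRestrict t u φ) ω
      = stepIntegral (fun s ω => Z (t + s) ω - Z t ω) ψ ω := by
  -- The maxima keep both times at least t, so the truncated subtraction in ℝ≥0 is exact.
  refine ⟨φ.mapDomain fun I => (max I.1 t - t, max (max I.1 t) (min I.2 u) - t), fun ω => ?_⟩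
  rw [stepIntegral_stepRestrict]
  unfold stepIntegral
  rw [Finsupp.sum_mapDomain_index (by simp) (by intros; ring)]
  refine Finsupp.sum_congr fun I _ => ?_
  have h1 : t + (max I.1 t - t) = max I.1 t := add_tsub_cancel_of_le (le_max_right _ _)
  have h2 : t + (max (max I.1 t) (min I.2 u) - t) = max (max I.1 t) (min I.2 u) :=
    add_tsub_cancel_of_le ((le_max_right _ _).trans (le_max_left _ _))
  have h3 : max (max I.1 t - t) (max (max I.1 t) (min I.2 u) - t)
      = max (max I.1 t) (min I.2 u) - t := max_eq_right (tsub_le_tsub_right (le_max_left _ _) _)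
  simp only [h3, h1, h2, sub_sub_sub_cancel_right]

/-- The Wiener integral over `(t, u]` is independent of `ℱ t`. -/
lemma IsWienerIntegral.indep [IsProbabilityMeasure P] (hZ : IsBrownianWrt Z ℱ P) {f : ℝ → ℝ}
    {J : Ω → ℝ} (hJ : Measurable J) {t u : ℝ≥0}
    (h : IsWienerIntegral P Z ((Set.Ioc (t : ℝ) u).indicator f) J) :
    Indep (MeasurableSpace.comap J inferInstance) (ℱ t) P := by
  obtain ⟨φ, -, hφ⟩ := h.exists_tendsto_ae hZ.brownian.toIsPreBrownianReal
  have hS (n : ℕ) : Measurable (stepIntegral Z (stepRestrict t u (φ n))) := by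
    unfold stepIntegral Finsupp.sum
    exact Finset.measurable_fun_sum _ fun I _ =>
      ((hZ.measurable _).sub (hZ.measurable _)).const_mul _
  rw [Indep_iff]
  rintro _ A ⟨C, hC, rfl⟩ hA
  rcases eq_or_ne (P A) 0 with hA0 | hA0
  · rw [hA0, mul_zero]
    exact measure_mono_null Set.inter_subset_right hA0
  have hprob : IsProbabilityMeasure P[|A] := cond_isProbabilityMeasure hA0
  -- Independence of A means that conditioning on A leaves the law of J unchanged. For elementary
  -- integrals both laws are the Gaussian determined by the same step function, and the limit
  -- inherits the equality.
  have hcond : P[|A].map J = P.map J := by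
    refine Measure.ext_of_charFun (funext fun x => ?_)
    refine tendsto_nhds_unique (tendsto_charFun_map (fun n => (hS n).aemeasurable)
      hJ.aemeasurable (cond_absolutelyContinuous.ae_le hφ) x) ?_
    refine (tendsto_charFun_map (fun n => (hS n).aemeasurable) hJ.aemeasurable hφ x).congr
      fun n => ?_
    obtain ⟨ψ, hψ⟩ := exists_stepIntegral_stepRestrict_eq_shift (Z := Z) t u (φ n)
    rw [funext hψ, (hZ.isPreBrownianReal_cond hA hA0).map_stepIntegral,
      (hZ.brownian.toIsPreBrownianReal.shift t).map_stepIntegral]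
  have h1 : P[|A] (J ⁻¹' C) = P (J ⁻¹' C) := by
    rw [← Measure.map_apply hJ hC, hcond, Measure.map_apply hJ hC]
  rw [cond_apply (ℱ.le t _ hA)] at h1
  rw [← h1, Set.inter_comm, mul_comm, ← mul_assoc, ENNReal.mul_inv_cancel hA0 (by simp), one_mul]

end Independence

/-! ### Mixtures of L² functions and the stochastic Fubini theorem. -/

section Mixture

variable {α β : Type*} {mα : MeasurableSpace α} {mβ : MeasurableSpace β} {ν : Measure α}
  {κ : Measure β} [SFinite κ] {ρ : α → ℝ} {G : α → β → ℝ} {C : ℝ}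

/-- Tonelli. The bound is asked only where ρ is nonzero, since in the application the integrand is a
Wiener integral only for times in the support of the weight. -/
lemma integrable_prod_mul_of_integral_le (hρ : Integrable ρ ν)
    {g : α → β → ℝ} (hg : AEStronglyMeasurable (Function.uncurry g) (ν.prod κ))
    (hgi : ∀ᵐ s ∂ν, ρ s ≠ 0 → Integrable (g s) κ ∧ ∫ x, ‖g s x‖ ∂κ ≤ C) :
    Integrable (fun z : α × β => ρ z.1 * g z.1 z.2) (ν.prod κ) := by
  have hm : AEStronglyMeasurable (fun z : α × β => ρ z.1 * g z.1 z.2) (ν.prod κ) :=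
    hρ.1.comp_fst.mul hg
  rw [integrable_prod_iff hm]
  refine ⟨?_, ?_⟩
  · filter_upwards [hgi] with s hs
    by_cases h : ρ s = 0
    · simp [h]
    · exact (hs h).1.const_mul _
  · refine (hρ.norm.mul_const C).mono' hm.norm.integral_prod_right' ?_
    filter_upwards [hgi] with s hs
    by_cases h : ρ s = 0
    · simp [h]
    · simp only [norm_mul]
      rw [integral_const_mul, Real.norm_of_nonneg
        (mul_nonneg (norm_nonneg _) (integral_nonneg fun _ => norm_nonneg _))]
      exact mul_le_mul_of_nonneg_left (hs h).2 (norm_nonneg _)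

lemma integrable_prod_mul_sq (hρ : Integrable ρ ν)
    (hG : AEStronglyMeasurable (Function.uncurry G) (ν.prod κ))
    (hGi : ∀ᵐ s ∂ν, ρ s ≠ 0 → MemLp (G s) 2 κ ∧ ∫ x, G s x ^ 2 ∂κ ≤ C) :
    Integrable (fun z : α × β => ρ z.1 * G z.1 z.2 ^ 2) (ν.prod κ) := by
  refine integrable_prod_mul_of_integral_le (C := C) (g := fun s x => G s x ^ 2) hρ (hG.pow 2) ?_
  filter_upwards [hGi] with s hs h
  exact ⟨(hs h).1.integrable_sq, by simpa using (hs h).2⟩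

lemma integrable_prod_mul_mul (hρ : Integrable ρ ν)
    (hG : AEStronglyMeasurable (Function.uncurry G) (ν.prod κ))
    (hGi : ∀ᵐ s ∂ν, ρ s ≠ 0 → MemLp (G s) 2 κ ∧ ∫ x, G s x ^ 2 ∂κ ≤ C) {h : β → ℝ}
    (hh : MemLp h 2 κ) :
    Integrable (fun z : α × β => ρ z.1 * (G z.1 z.2 * h z.2)) (ν.prod κ) := by
  refine integrable_prod_mul_of_integral_le (C := C + ∫ x, h x ^ 2 ∂κ)
    (g := fun s x => G s x * h x) hρ (hG.mul hh.1.comp_snd) ?_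
  filter_upwards [hGi] with s hs hρs
  obtain ⟨h1, h2⟩ := hs hρs
  have hi : Integrable (fun x => G s x * h x) κ := h1.integrable_mul hh
  refine ⟨hi, ?_⟩
  calc ∫ x, ‖G s x * h x‖ ∂κ ≤ ∫ x, (G s x ^ 2 + h x ^ 2) ∂κ := by
        refine integral_mono hi.norm (h1.integrable_sq.add hh.integrable_sq) fun x => ?_
        simp only [Real.norm_eq_abs]
        refine abs_le.2 ⟨?_, ?_⟩ <;> nlinarith [sq_nonneg (G s x + h x), sq_nonneg (G s x - h x)]
    _ ≤ _ := by rw [integral_add h1.integrable_sq hh.integrable_sq]; gcongr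

variable [SFinite ν]

/-- Minkowski's inequality in qualitative form: a mixture of functions that are bounded in `L^2` is
in `L^2`. -/
lemma memLp_two_integral_mul (hρ : Integrable ρ ν)
    (hG : AEStronglyMeasurable (Function.uncurry G) (ν.prod κ))
    (hGi : ∀ᵐ s ∂ν, ρ s ≠ 0 → MemLp (G s) 2 κ ∧ ∫ x, G s x ^ 2 ∂κ ≤ C) :
    MemLp (fun x => ∫ s, ρ s * G s x ∂ν) 2 κ := by
  have hm : AEStronglyMeasurable (fun z : α × β => ρ z.1 * G z.1 z.2) (ν.prod κ) :=
    hρ.1.comp_fst.mul hG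
  have hm' : AEStronglyMeasurable (fun x => ∫ s, ρ s * G s x ∂ν) κ :=
    hm.prod_swap.integral_prod_right'
  have h1 := integrable_prod_mul_sq hρ hG hGi
  have h2 := h1.norm.integral_prod_right
  rw [memLp_two_iff_integrable_sq hm']
  refine (h2.const_mul (∫ s, ‖ρ s‖ ∂ν)).mono' (hm'.pow 2) ?_
  filter_upwards [h1.prod_left_ae, hG.prod_swap.prodMk_left] with x hx hGx
  -- Split |ρ G| as √|ρ| · (√|ρ| |G|). Cauchy–Schwarz in s then bounds the squared mixture by ‖ρ‖₁ ∫
  -- |ρ| G², which is integrable in x.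
  have hρm : AEStronglyMeasurable (fun s => √‖ρ s‖) ν :=
    Real.continuous_sqrt.comp_aestronglyMeasurable hρ.1.norm
  have ha : MemLp (fun s => √‖ρ s‖) 2 ν := by
    rw [memLp_two_iff_integrable_sq hρm]
    simpa using hρ.norm
  have hbm : AEStronglyMeasurable (fun s => √‖ρ s‖ * ‖G s x‖) ν := hρm.mul hGx.norm
  have hb : MemLp (fun s => √‖ρ s‖ * ‖G s x‖) 2 ν := by
    rw [memLp_two_iff_integrable_sq hbm]
    refine hx.norm.congr (ae_of_all _ fun s => ?_)
    simp [mul_pow]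
  have hnorm : ‖∫ s, ρ s * G s x ∂ν‖ ≤ ∫ s, √‖ρ s‖ * (√‖ρ s‖ * ‖G s x‖) ∂ν := by
    refine (norm_integral_le_integral_norm _).trans_eq (integral_congr_ae (ae_of_all _ fun s => ?_))
    simp only [norm_mul]
    rw [← mul_assoc, Real.mul_self_sqrt (norm_nonneg _)]
  have hcs := integral_mul_le_Lp_mul_Lq_of_nonneg (μ := ν) (Real.HolderConjugate.two_two)
    (ae_of_all _ fun s => Real.sqrt_nonneg ‖ρ s‖)
    (ae_of_all _ fun s => mul_nonneg (Real.sqrt_nonneg ‖ρ s‖) (norm_nonneg (G s x)))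
    (by simpa using ha) (by simpa using hb)
  have hsq := (hnorm.trans hcs)
  have e1 : ∫ s, (√‖ρ s‖) ^ (2 : ℝ) ∂ν = ∫ s, ‖ρ s‖ ∂ν := by simp
  have e2 : ∫ s, (√‖ρ s‖ * ‖G s x‖) ^ (2 : ℝ) ∂ν = ∫ s, ‖ρ s * G s x ^ 2‖ ∂ν := by
    simp [mul_pow]
  rw [e1, e2, ← Real.sqrt_eq_rpow, ← Real.sqrt_eq_rpow, ← Real.sqrt_mul
    (integral_nonneg fun _ => norm_nonneg _)] at hsq
  rw [norm_pow]
  calc ‖∫ s, ρ s * G s x ∂ν‖ ^ 2 ≤ _ := pow_le_pow_left₀ (norm_nonneg _) hsq 2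
    _ = _ := Real.sq_sqrt (mul_nonneg (integral_nonneg fun _ => norm_nonneg _)
        (integral_nonneg fun _ => norm_nonneg _))

lemma integral_mixture_mul (hρ : Integrable ρ ν)
    (hG : AEStronglyMeasurable (Function.uncurry G) (ν.prod κ))
    (hGi : ∀ᵐ s ∂ν, ρ s ≠ 0 → MemLp (G s) 2 κ ∧ ∫ x, G s x ^ 2 ∂κ ≤ C) {h : β → ℝ}
    (hh : MemLp h 2 κ) :
    ∫ x, (∫ s, ρ s * G s x ∂ν) * h x ∂κ = ∫ s, ρ s * ∫ x, G s x * h x ∂κ ∂ν := by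
  have hi := integrable_prod_mul_mul hρ hG hGi hh
  simp_rw [← integral_const_mul, ← integral_mul_const, mul_assoc]
  exact (integral_integral_swap hi).symm

end Mixture

/-- The stochastic Fubini theorem for Wiener integrals. -/
lemma IsWienerIntegral.integral_mixture {Ω : Type*} {mΩ : MeasurableSpace Ω} {P : Measure Ω}
    [IsProbabilityMeasure P] {Z : ℝ≥0 → Ω → ℝ} (hZ : IsPreBrownianReal Z P)
    {ρ : ℝ → ℝ} (hρ : Integrable ρ) {κ : ℝ → ℝ → ℝ} {N : ℝ → Ω → ℝ} {C : ℝ}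
    (hκ : AEStronglyMeasurable (Function.uncurry κ) (volume.prod volume))
    (hN : AEStronglyMeasurable (Function.uncurry N) (volume.prod P))
    (hW : ∀ᵐ s, ρ s ≠ 0 → IsWienerIntegral P Z (κ s) (N s) ∧ ∫ x, κ s x ^ 2 ≤ C)
    (hκ0 : ∀ s, ∀ x ≤ 0, κ s x = 0) :
    IsWienerIntegral P Z (fun x => ∫ s, ρ s * κ s x) (fun ω => ∫ s, ρ s * N s ω) := by
  have hκi : ∀ᵐ s, ρ s ≠ 0 → MemLp (κ s) 2 volume ∧ ∫ x, κ s x ^ 2 ≤ C := by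
    filter_upwards [hW] with s hs h using ⟨(hs h).1.memLp_fun, (hs h).2⟩
  have hNi : ∀ᵐ s, ρ s ≠ 0 → MemLp (N s) 2 P ∧ ∫ ω, N s ω ^ 2 ∂P ≤ C := by
    filter_upwards [hW] with s hs h
    exact ⟨(hs h).1.memLp_integral, ((hs h).1.integral_sq hZ).trans_le (hs h).2⟩
  have hf := memLp_two_integral_mul hρ hκ hκi
  have hJ := memLp_two_integral_mul hρ hN hNi
  obtain ⟨I, hI⟩ := exists_isWienerIntegral hZ hf
    (ae_of_all _ fun x hx => by simp [hκ0 _ x hx])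
  refine hI.congr (EventuallyEq.refl _ _)
    (ae_eq_of_integral_sub_sq_eq_zero hI.memLp_integral hJ ?_)
  set f : ℝ → ℝ := fun x => ∫ s, ρ s * κ s x with hf_def
  set J : Ω → ℝ := fun ω => ∫ s, ρ s * N s ω with hJ_def
  -- J pairs with every Wiener integral V as f pairs with its integrand. Taking V = N s and
  -- integrating in s gives E[J²] = ∫ f², and V = I gives E[JI] = ∫ f². Hence E[(I − J)²] = 0.
  have hJW {g : ℝ → ℝ} {V : Ω → ℝ} (hV : IsWienerIntegral P Z g V) :
      ∫ ω, J ω * V ω ∂P = ∫ x, f x * g x := by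
    rw [hJ_def, hf_def, integral_mixture_mul hρ hN hNi hV.memLp_integral,
      integral_mixture_mul hρ hκ hκi hV.memLp_fun]
    refine integral_congr_ae ?_
    filter_upwards [hW] with s hs
    by_cases h : ρ s = 0
    · simp [h]
    · simp only [(hs h).1.integral_mul hZ hV]
  have hJJ : ∫ ω, J ω * J ω ∂P = ∫ x, f x * f x := by
    conv_lhs => enter [2, ω, 1]; rw [hJ_def]
    conv_rhs => enter [2, x, 1]; rw [hf_def]
    rw [integral_mixture_mul hρ hN hNi hJ, integral_mixture_mul hρ hκ hκi hf]
    refine integral_congr_ae ?_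
    filter_upwards [hW] with s hs
    by_cases h : ρ s = 0
    · simp [h]
    · simp only [mul_comm (N s _), mul_comm (κ s _), hJW (hs h).1]
  have h1 : ∫ ω, (I ω - J ω) ^ 2 ∂P
      = ∫ ω, I ω ^ 2 ∂P - 2 * ∫ ω, J ω * I ω ∂P + ∫ ω, J ω * J ω ∂P := by
    have hIJ : Integrable (fun ω => J ω * I ω) P := hJ.integrable_mul hI.memLp_integral
    have hJJi : Integrable (fun ω => J ω * J ω) P := hJ.integrable_mul hJ
    have hsub : Integrable (fun ω => I ω ^ 2 - 2 * (J ω * I ω)) P :=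
      hI.memLp_integral.integrable_sq.sub (hIJ.const_mul 2)
    rw [← integral_const_mul, ← integral_sub hI.memLp_integral.integrable_sq (hIJ.const_mul 2),
      ← integral_add hsub hJJi]
    exact integral_congr_ae (ae_of_all _ fun ω => by ring)
  rw [h1, hJJ, hJW hI, hI.integral_sq hZ]
  simp only [sq]
  ring

/-! ### A jointly measurable version of a continuous process. -/

section Modification

variable {Ω : Type*} {mΩ : MeasurableSpace Ω} {P : Measure Ω}

/-- A process with almost surely continuous paths on `[0, u]` has a version that is bounded along
each path and jointly measurable. -/
lemma exists_measurable_modification {X : ℝ≥0 → Ω → ℝ} {u : ℝ≥0}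
    (hm : ∀ t ≤ u, AEMeasurable (X t) P)
    (hc : ∀ᵐ ω ∂P, ContinuousOn (fun t => X t ω) (Set.Iic u)) :
    ∃ x : ℝ → Ω → ℝ, Measurable (Function.uncurry x) ∧ (∀ ω, ∃ B, ∀ s, ‖x s ω‖ ≤ B) ∧
      (∀ s ∉ Set.Icc (0 : ℝ) u, ∀ ω, x s ω = 0) ∧
      ∀ᵐ ω ∂P, ∀ s : ℝ≥0, s ≤ u → x s ω = X s ω := by
  let d (n : ℕ) : ℝ≥0 := min (TopologicalSpace.denseSeq ℝ≥0 n) u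
  have hd (n : ℕ) : d n ≤ u := min_le_right _ _
  let V (n : ℕ) : Ω → ℝ := (hm (d n) (hd n)).mk (X (d n))
  have hgood : ∀ᵐ ω ∂P, ContinuousOn (fun t => X t ω) (Set.Iic u) ∧ ∀ n, X (d n) ω = V n ω :=
    hc.and (ae_all_iff.2 fun n => (hm (d n) (hd n)).ae_eq_mk)
  obtain ⟨N, hN, hNm, hN0⟩ := exists_measurable_superset_of_null hgood
  have hG (ω : Ω) (hω : ω ∈ Nᶜ) :
      ContinuousOn (fun t => X t ω) (Set.Iic u) ∧ ∀ n, X (d n) ω = V n ω := by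
    by_contra h
    exact hω (hN h)
  -- Setting paths to zero on the exceptional null set and freezing them after u makes every path
  -- continuous. Measurability at each time then follows from a dense sequence of times.
  let y (t : ℝ≥0) : Ω → ℝ := Nᶜ.indicator (X (min t u))
  have hycont (ω : Ω) : Continuous fun t => y t ω := by
    by_cases hω : ω ∈ Nᶜ
    · simp only [y, Set.indicator_of_mem hω]
      exact (hG ω hω).1.comp_continuous (by fun_prop) fun t => min_le_right t u
    · simp only [y, Set.indicator_of_notMem hω]
      exact continuous_const
  have hymeas (t : ℝ≥0) : Measurable (y t) := by
    obtain ⟨a, ha, hlim⟩ := mem_closure_iff_seq_limit.1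
      (TopologicalSpace.denseRange_denseSeq ℝ≥0 t)
    choose k hk using ha
    refine measurable_of_tendsto_metrizable (f := fun n => Nᶜ.indicator (V (k n)))
      (fun n => (AEMeasurable.measurable_mk _).indicator hNm.compl) (tendsto_pi_nhds.2 fun ω => ?_)
    refine (((hycont ω).tendsto t).comp hlim).congr fun n => ?_
    by_cases hω : ω ∈ Nᶜ
    · simp only [Function.comp_apply, y, Set.indicator_of_mem hω]
      rw [← (hG ω hω).2, ← hk]
    · simp [y, Set.indicator_of_notMem hω]
  have hyj := measurable_uncurry_of_continuous_of_measurable hycont hymeas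
  refine ⟨fun s ω => (Set.Icc (0 : ℝ) u).indicator (fun s => y s.toNNReal ω) s, ?_, fun ω => ?_,
    fun s hs ω => Set.indicator_of_notMem hs _, ?_⟩
  · have h1 : Measurable fun z : ℝ × Ω => y z.1.toNNReal z.2 :=
      hyj.comp ((measurable_real_toNNReal.comp measurable_fst).prodMk measurable_snd)
    have h2 : MeasurableSet (Prod.fst ⁻¹' Set.Icc (0 : ℝ) u : Set (ℝ × Ω)) :=
      measurable_fst measurableSet_Icc
    exact h1.indicator h2
  · obtain ⟨B, hB⟩ := (isCompact_Icc (a := (0 : ℝ≥0)) (b := u)).exists_bound_of_continuousOn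
      (hycont ω).continuousOn
    refine ⟨B, fun s => ?_⟩
    by_cases hs : s ∈ Set.Icc (0 : ℝ) u
    · simp only [Set.indicator_of_mem hs]
      exact hB _ ⟨zero_le, Real.toNNReal_le_iff_le_coe.2 hs.2⟩
    · simp only [Set.indicator_of_notMem hs, norm_zero]
      exact (norm_nonneg _).trans (hB 0 ⟨le_rfl, zero_le⟩)
  · have hN' : ∀ᵐ ω ∂P, ω ∈ Nᶜ := measure_eq_zero_iff_ae_notMem.1 hN0
    filter_upwards [hN'] with ω hω s hs
    have hsu : (s : ℝ) ∈ Set.Icc (0 : ℝ) u := ⟨s.2, NNReal.coe_le_coe.2 hs⟩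
    simp only [y, Set.indicator_of_mem hsu, Set.indicator_of_mem hω, Real.toNNReal_coe, min_eq_left hs]

end Modification

/-! ### Volterra convolutions as convolutions on the whole line. -/

section Convolution

/-- The convolution of functions on the real line. -/
noncomputable def realConv (f g : ℝ → ℝ) (t : ℝ) : ℝ := ∫ s, f s * g (t - s)

lemma realConv_comm (f g : ℝ → ℝ) (t : ℝ) : realConv f g t = ∫ s, f (t - s) * g s := by
  unfold realConv
  rw [← integral_sub_left_eq_self _ volume t]
  simp

/-- `f'` is a measurable version of `f` on `[0, u]` that vanishes outside `[0, u]`. -/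
structure IsCutoff (u : ℝ) (f f' : ℝ → ℝ) : Prop where
  measurable : Measurable f'
  zero : ∀ s ∉ Set.Icc 0 u, f' s = 0
  ae_eq : ∀ᵐ s : ℝ, s ∈ Set.Icc 0 u → f' s = f s

variable {u : ℝ} {f f' g g' : ℝ → ℝ}

lemma exists_isCutoff (hf : AEStronglyMeasurable f (volume.restrict (Set.Icc 0 u))) :
    ∃ f', IsCutoff u f f' := by
  refine ⟨(Set.Icc 0 u).indicator (hf.mk f),
    hf.stronglyMeasurable_mk.measurable.indicator measurableSet_Icc,
    fun s hs => Set.indicator_of_notMem hs _, ?_⟩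
  filter_upwards [(ae_restrict_iff' measurableSet_Icc).1 hf.ae_eq_mk] with s hs hsu
  rw [Set.indicator_of_mem hsu, hs hsu]

lemma isCutoff_of_continuousOn (hf : ContinuousOn f (Set.Icc 0 u)) :
    IsCutoff u f ((Set.Icc 0 u).indicator f) where
  measurable := by
    classical
    rw [← Set.piecewise_eq_indicator]
    exact hf.measurable_piecewise continuousOn_const measurableSet_Icc
  zero s hs := Set.indicator_of_notMem hs _
  ae_eq := ae_of_all _ fun s hs => Set.indicator_of_mem hs _

lemma IsCutoff.memLp {p : ℝ≥0∞} (h : IsCutoff u f f')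
    (hf : MemLp f p (volume.restrict (Set.Icc 0 u))) : MemLp f' p volume := by
  have h1 : f' = (Set.Icc 0 u).indicator f' := by
    ext s
    by_cases hs : s ∈ Set.Icc 0 u
    · rw [Set.indicator_of_mem hs]
    · rw [Set.indicator_of_notMem hs, h.zero s hs]
  rw [h1, memLp_indicator_iff_restrict measurableSet_Icc]
  refine (memLp_congr_ae ?_).2 hf
  exact (ae_restrict_iff' measurableSet_Icc).2 h.ae_eq

lemma IsCutoff.mul_const (h : IsCutoff u f f') (c : ℝ) :
    IsCutoff u (fun s => f s * c) (fun s => f' s * c) where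
  measurable := h.measurable.mul_const c
  zero s hs := by simp [h.zero s hs]
  ae_eq := by filter_upwards [h.ae_eq] with s hs hsu using by rw [hs hsu]

lemma ae_sub_left {p : ℝ → Prop} (h : ∀ᵐ s, p s) (t : ℝ) : ∀ᵐ s, p (t - s) :=
  (quasiMeasurePreserving_sub_left_of_right_invariant volume t).ae h

/-- The supports confine the integrand to [0,t], so the limits of integration can be dropped, and
translation invariance and Fubini on ℝ become available. -/
lemma IsCutoff.intervalIntegral_eq (hf : IsCutoff u f f') (hg : IsCutoff u g g') {t : ℝ}
    (ht : t ∈ Set.Icc 0 u) : ∫ s in (0 : ℝ)..t, f s * g (t - s) = realConv f' g' t := by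
  rw [intervalIntegral.integral_of_le ht.1, ← integral_indicator measurableSet_Ioc]
  refine integral_congr_ae ?_
  -- The point 0 is discarded because (0,t] omits it while f' may be nonzero there.
  filter_upwards [hf.ae_eq, ae_sub_left hg.ae_eq t, compl_mem_ae_iff.2 (measure_singleton (0 : ℝ))]
    with s h1 h2 h3
  by_cases hs : s ∈ Set.Ioc 0 t
  · rw [Set.indicator_of_mem hs, h1 ⟨hs.1.le, hs.2.trans ht.2⟩,
      h2 ⟨sub_nonneg.2 hs.2, (sub_le_self _ hs.1.le).trans ht.2⟩]
  · rw [Set.indicator_of_notMem hs]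
    rcases lt_trichotomy s 0 with h | h | h
    · rw [hf.zero s fun h' => h.not_ge h'.1, zero_mul]
    · exact absurd h h3
    · have : t < s := by by_contra! h'; exact hs ⟨h, h'⟩
      rw [hg.zero (t - s) fun h' => (sub_neg.2 this).not_ge h'.1, mul_zero]

lemma IsCutoff.intervalIntegral_eq' (hf : IsCutoff u f f') (hg : IsCutoff u g g') {t : ℝ}
    (ht : t ∈ Set.Icc 0 u) : ∫ s in (0 : ℝ)..t, f (t - s) * g s = realConv f' g' t := by
  have h := intervalIntegral.integral_comp_sub_left (a := 0) (b := t) (fun s => f s * g (t - s)) t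
  simp only [sub_sub_cancel, sub_self, sub_zero] at h
  rw [h, hf.intervalIntegral_eq hg ht]

lemma measurable_realConv {α : Type*} {mα : MeasurableSpace α} {F G : α → ℝ → ℝ} {τ : α → ℝ}
    (hF : Measurable (Function.uncurry F)) (hG : Measurable (Function.uncurry G))
    (hτ : Measurable τ) : Measurable fun a => realConv (F a) (G a) (τ a) := by
  have h1 : Measurable fun z : α × ℝ => F z.1 z.2 * G z.1 (τ z.1 - z.2) :=
    (hF.comp (measurable_fst.prodMk measurable_snd)).mul
      (hG.comp (measurable_fst.prodMk ((hτ.comp measurable_fst).sub measurable_snd)))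
  exact h1.stronglyMeasurable.integral_prod_right'.measurable

lemma MemLp.comp_sub_left {p : ℝ≥0∞} (hf : MemLp f p volume) (t : ℝ) :
    MemLp (fun s => f (t - s)) p volume :=
  hf.comp_measurePreserving (Measure.measurePreserving_sub_left volume t)

/-- Young's inequality in qualitative form. -/
lemma memLp_two_realConv (hf : Integrable f) (hg : MemLp g 2 volume) (hgm : Measurable g) :
    MemLp (realConv f g) 2 volume := by
  -- A convolution is a mixture of translates of g, all with the same L² norm.
  refine memLp_two_integral_mul (G := fun s x => g (x - s)) (C := ∫ x, g x ^ 2) hf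
    (hgm.comp (measurable_snd.sub measurable_fst)).aestronglyMeasurable (ae_of_all _ fun s _ => ?_)
  refine ⟨hg.comp_measurePreserving (measurePreserving_sub_right volume s), ?_⟩
  rw [integral_sub_right_eq_self (fun x => g x ^ 2) s]

/-- Hölder. Reflection and translation preserve the norm of g, so the bound is uniform in t, as
`realConv_resolvent` requires. -/
lemma exists_integral_norm_mul_le {p q : ℝ≥0∞} (hpq : p⁻¹ + q⁻¹ = 1) (hf : MemLp f p volume)
    (hg : MemLp g q volume) :
    ∃ C, ∀ t, Integrable (fun s => f s * g (t - s)) ∧ ∫ s, ‖f s * g (t - s)‖ ≤ C := by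
  have : ENNReal.HolderConjugate p q := ENNReal.holderConjugate_iff.2 hpq
  refine ⟨(eLpNorm f p volume * eLpNorm g q volume).toReal, fun t => ?_⟩
  have hi : Integrable (fun s => f s * g (t - s)) := hf.integrable_mul (MemLp.comp_sub_left hg t)
  refine ⟨hi, ?_⟩
  rw [integral_norm_eq_lintegral_enorm hi.1, ← eLpNorm_one_eq_lintegral_enorm]
  refine ENNReal.toReal_mono (ENNReal.mul_ne_top hf.2.ne hg.2.ne) ?_
  refine (eLpNorm_smul_le_mul_eLpNorm (p := p) (q := q) (r := 1) (MemLp.comp_sub_left hg t).1 hf.1).trans_eq ?_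
  congr 1
  exact eLpNorm_comp_measurePreserving hg.1 (Measure.measurePreserving_sub_left volume t)

/-- Associativity of the convolution, combined with the resolvent equation. -/
lemma realConv_resolvent {ρ k m : ℝ → ℝ} {C : ℝ} (hρ : Integrable ρ)
    (hk : Measurable k) (hm : Measurable m) (hm0 : ∀ s ∉ Set.Icc 0 u, m s = 0)
    (hC : ∀ t, Integrable (fun s => k s * m (t - s)) ∧ ∫ s, ‖k s * m (t - s)‖ ≤ C)
    (hres : ∀ᵐ t : ℝ, t ∈ Set.Icc 0 u → realConv ρ k t = k t - ρ t) :
    Integrable (fun s => ρ s * m (u - s)) ∧ Integrable (fun s => ρ s * realConv k m (u - s)) ∧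
      realConv ρ (realConv k m) u = realConv k m u - realConv ρ m u := by
  have hshift (s : ℝ) : (fun r => k (r - s) * m (u - r))
      = fun r => (fun v => k v * m (u - s - v)) (r - s) := by
    ext r; simp only; congr 2; ring
  have hprod : Integrable (fun z : ℝ × ℝ => ρ z.1 * (k (z.2 - z.1) * m (u - z.2)))
      (volume.prod volume) := by
    refine integrable_prod_mul_of_integral_le (C := C) (g := fun s r => k (r - s) * m (u - r)) hρ
      (Measurable.aestronglyMeasurable ?_) (ae_of_all _ fun s _ => ?_)
    · exact (hk.comp (measurable_snd.sub measurable_fst)).mul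
        (hm.comp (measurable_const.sub measurable_snd))
    · rw [hshift s]
      refine ⟨(hC (u - s)).1.comp_sub_right s, ?_⟩
      refine le_trans (le_of_eq ?_) (hC (u - s)).2
      rw [← integral_sub_right_eq_self (fun v => ‖k v * m (u - s - v)‖) s]
      exact integral_congr_ae (ae_of_all _ fun r => congrArg norm (congrFun (hshift s) r))
  have hinner (s : ℝ) : ∫ r, ρ s * (k (r - s) * m (u - r)) = ρ s * realConv k m (u - s) := by
    rw [integral_const_mul, hshift s, integral_sub_right_eq_self (fun v => k v * m (u - s - v)) s]
    rfl
  -- Integrating over s first produces (ρ⋆k)(r) m(u − r), and m(u − r) = 0 unless r ∈ [0,u]. An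
  -- almost everywhere resolvent equation thus yields an identity at the point u itself.
  have hinner' : (fun r => ∫ s, ρ s * (k (r - s) * m (u - r)))
      =ᵐ[volume] fun r => k r * m (u - r) - ρ r * m (u - r) := by
    filter_upwards [hres] with r hr
    simp_rw [← mul_assoc]
    rw [integral_mul_const]
    by_cases h : r ∈ Set.Icc 0 u
    · rw [← sub_mul, ← hr h]; rfl
    · have h' : u - r ∉ Set.Icc 0 u := fun h' => h ⟨by linarith [h'.2], by linarith [h'.1]⟩
      simp [hm0 _ h']
  have h1 := hprod.integral_prod_left
  have h2 := hprod.integral_prod_right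
  simp only [hinner] at h1
  have h3 := h2.congr hinner'
  -- With ρ merely in L¹ and m possibly unbounded, integrability is obtained from that of the other
  -- two terms of the resolvent identity.
  have h4 : Integrable (fun r => ρ r * m (u - r)) :=
    ((hC u).1.sub h3).congr (ae_of_all _ fun r => by simp)
  refine ⟨h4, h1, ?_⟩
  calc realConv ρ (realConv k m) u = ∫ s, ∫ r, ρ s * (k (r - s) * m (u - r)) := by
        simp_rw [hinner]; rfl
    _ = ∫ r, ∫ s, ρ s * (k (r - s) * m (u - r)) := integral_integral_swap hprod
    _ = ∫ r, (k r * m (u - r) - ρ r * m (u - r)) := integral_congr_ae hinner'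
    _ = _ := integral_sub (hC u).1 h4

end Convolution

/-! ### The kernel E_θ and its Wiener integrals. -/

section Kernel

variable {u : ℝ} {K K' R R' : ℝ → ℝ}

lemma isCutoff_kernelE (hK : IsCutoff u K K') (hR : IsCutoff u R R') :
    IsCutoff u (kernelE K R) ((Set.Icc 0 u).indicator fun t => K' t - realConv R' K' t) where
  measurable := by
    have h : Measurable (realConv R' K') := measurable_realConv (F := fun _ => R')
      (G := fun _ => K') (hR.measurable.comp measurable_snd) (hK.measurable.comp measurable_snd)
      measurable_id
    exact (hK.measurable.sub h).indicator measurableSet_Icc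
  zero s hs := Set.indicator_of_notMem hs _
  ae_eq := by
    filter_upwards [hK.ae_eq] with s hs hsu
    rw [Set.indicator_of_mem hsu, hs hsu, ← hR.intervalIntegral_eq hK hsu]
    rfl

lemma memLp_kernelE (hK : MemLp K 2 (volume.restrict (Set.Icc 0 u)))
    (hR : MemLp R 1 (volume.restrict (Set.Icc 0 u))) :
    MemLp (kernelE K R) 2 (volume.restrict (Set.Icc 0 u)) := by
  obtain ⟨K', hK'⟩ := exists_isCutoff hK.1
  obtain ⟨R', hR'⟩ := exists_isCutoff hR.1
  have hE := isCutoff_kernelE hK' hR'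
  refine (memLp_congr_ae ((ae_restrict_iff' measurableSet_Icc).2 hE.ae_eq)).1 (MemLp.restrict _ ?_)
  exact ((hK'.memLp hK).sub (memLp_two_realConv (memLp_one_iff_integrable.1 (hR'.memLp hR))
    (hK'.memLp hK) hK'.measurable)).indicator measurableSet_Icc

lemma memLp_indicator_Ioc_comp_sub (hK : MemLp K 2 (volume.restrict (Set.Icc 0 u))) {a b t : ℝ}
    (ha : 0 ≤ a) (hbt : b ≤ t) (htu : t ≤ u) (c : ℝ) :
    MemLp ((Set.Ioc a b).indicator fun s => K (t - s) * c) 2 volume := by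
  have h1 : MemLp ((Set.Icc 0 u).indicator K) 2 volume :=
    (memLp_indicator_iff_restrict measurableSet_Icc).2 hK
  have h2 := ((MemLp.comp_sub_left h1 t).mul_const c).indicator
    (measurableSet_Ioc (a := a) (b := b))
  refine (memLp_congr_ae (ae_of_all _ fun s => ?_)).2 h2
  by_cases hs : s ∈ Set.Ioc a b
  · have hts : t - s ∈ Set.Icc 0 u := ⟨sub_nonneg.2 (hs.2.trans hbt), by linarith [hs.1]⟩
    rw [Set.indicator_of_mem hs, Set.indicator_of_mem hs, Set.indicator_of_mem hts]
  · rw [Set.indicator_of_notMem hs, Set.indicator_of_notMem hs]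

/-- Excludes the default value 0 in the definition of `wienerIntegral`. -/
lemma isWienerIntegral_wienerIntegral {Ω : Type*} {mΩ : MeasurableSpace Ω} {P : Measure Ω}
    {Z : ℝ≥0 → Ω → ℝ} (hZ : IsPreBrownianReal Z P) {a b : ℝ} {f : ℝ → ℝ} (ha : 0 ≤ a)
    (hf : MemLp ((Set.Ioc a b).indicator f) 2 volume) :
    IsWienerIntegral P Z ((Set.Ioc a b).indicator f) (wienerIntegral P Z a b f) := by
  have h := exists_isWienerIntegral hZ hf
    (ae_of_all _ fun s hs => Set.indicator_of_notMem (fun h => (ha.trans_lt h.1).not_ge hs) _)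
  unfold wienerIntegral
  rw [dif_pos h]
  exact h.choose_spec

/-- A rearrangement of R⋆(θK) = θK − R; it turns the drift term H into R⋆μ. -/
lemma IsResolvent.kernelE_mul_ae_eq {θ : ℝ} (hR : IsResolvent (fun t => K t * θ) R) :
    ∀ᵐ t : ℝ, 0 ≤ t → kernelE K R t * θ = R t := by
  filter_upwards [hR.right_eq] with t ht h0
  have h := ht h0
  unfold volterraConv at h
  simp_rw [← mul_assoc] at h
  rw [intervalIntegral.integral_mul_const] at h
  unfold kernelE volterraConv
  linear_combination -h

end Kernel

/-! ### Variation of constants for the Volterra equation. -/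

section Solution

variable {Ω : Type*} {mΩ : MeasurableSpace Ω} {P : Measure Ω} [IsProbabilityMeasure P]
  {ℱ : Filtration ℝ≥0 mΩ} {Z : ℝ≥0 → Ω → ℝ} {K μ F R : ℝ → ℝ} {θ σ T : ℝ} {X : ℝ≥0 → Ω → ℝ}

/-- The stochastic convolution `M_s = ∫_0^s K(s-r) σ dZ_r`, minus its convolution with the
resolvent, is the Gaussian Volterra process with kernel `E_θ`. -/
lemma ae_eq_processY_of_wienerIntegral (hZ : IsPreBrownianReal Z P) {u : ℝ≥0}
    {K' R' : ℝ → ℝ} {N : ℝ → Ω → ℝ} (hK2 : MemLp K 2 (volume.restrict (Set.Icc 0 (u : ℝ))))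
    (hR1 : MemLp R 1 (volume.restrict (Set.Icc 0 (u : ℝ))))
    (hK' : IsCutoff u K K') (hR' : IsCutoff u R R') (hN : Measurable (Function.uncurry N))
    (hNW : ∀ s ∈ Set.Icc (0 : ℝ) u, N s =ᵐ[P] wienerIntegral P Z 0 s (fun r => K (s - r) * σ)) :
    (fun ω => N u ω - ∫ s, R' (u - s) * N s ω) =ᵐ[P] processY P Z (kernelE K R) σ 0 u u := by
  have hK'2 := hK'.memLp hK2
  have hρ : Integrable fun s => R' (u - s) :=
    memLp_one_iff_integrable.1 (MemLp.comp_sub_left (hR'.memLp hR1) u)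
  -- The cutoff K' already vanishes for r > s, so only r ≤ 0 has to be removed.
  let κ (s : ℝ) : ℝ → ℝ := (Set.Ioi 0).indicator fun r => K' (s - r) * σ
  have hκ : Measurable (Function.uncurry κ) := by
    have h1 : Measurable fun z : ℝ × ℝ => K' (z.1 - z.2) * σ :=
      (hK'.measurable.comp (measurable_fst.sub measurable_snd)).mul_const σ
    have h2 : MeasurableSet (Prod.snd ⁻¹' Set.Ioi (0 : ℝ) : Set (ℝ × ℝ)) :=
      measurable_snd measurableSet_Ioi
    exact h1.indicator h2
  have hκW (s : ℝ) (hs : s ∈ Set.Icc (0 : ℝ) u) : IsWienerIntegral P Z (κ s) (N s) := by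
    refine (isWienerIntegral_wienerIntegral hZ le_rfl
      (memLp_indicator_Ioc_comp_sub hK2 le_rfl le_rfl hs.2 σ)).congr ?_ (hNW s hs).symm
    filter_upwards [ae_sub_left hK'.ae_eq s] with r hr
    by_cases hr0 : 0 < r
    · simp only [κ, Set.indicator_of_mem (Set.mem_Ioi.2 hr0)]
      by_cases hrs : r ≤ s
      · rw [Set.indicator_of_mem (Set.mem_Ioc.2 ⟨hr0, hrs⟩), hr ⟨by linarith, by linarith [hs.2]⟩]
      · rw [Set.indicator_of_notMem fun h => hrs h.2, hK'.zero _ fun h => hrs (by linarith [h.1]),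
          zero_mul]
    · rw [Set.indicator_of_notMem fun h => hr0 h.1]
      exact (Set.indicator_of_notMem (fun h => hr0 h) _).symm
  have hκC (s : ℝ) : ∫ r, κ s r ^ 2 ≤ ∫ r, (K' r * σ) ^ 2 := by
    rw [← integral_sub_left_eq_self (fun r => (K' r * σ) ^ 2) volume s]
    refine integral_mono_of_nonneg (ae_of_all _ fun r => sq_nonneg _)
      ((MemLp.comp_sub_left hK'2 s).mul_const σ).integrable_sq (ae_of_all _ fun r => ?_)
    by_cases hr : r ∈ Set.Ioi (0 : ℝ)
    · simp only [κ, Set.indicator_of_mem hr, le_refl]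
    · simp only [κ, Set.indicator_of_notMem hr]
      exact (zero_pow two_ne_zero).trans_le (sq_nonneg _)
  have hmix := IsWienerIntegral.integral_mixture hZ hρ (C := ∫ r, (K' r * σ) ^ 2)
    hκ.aestronglyMeasurable hN.aestronglyMeasurable
    (ae_of_all _ fun s hs => ⟨hκW s ?_, hκC s⟩)
    (fun s x hx => Set.indicator_of_notMem (fun h => not_lt.2 hx h) _)
  swap
  · by_contra h
    exact hs (hR'.zero _ fun h' => h ⟨by linarith [h'.2], by linarith [h'.1]⟩)
  have huu : (u : ℝ) ∈ Set.Icc (0 : ℝ) u := ⟨u.2, le_rfl⟩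
  have hW := ((hκW u huu).sub hZ hmix).congr (g := (Set.Ioc (0 : ℝ) u).indicator
    fun s => kernelE K R (u - s) * σ) ?_ (EventuallyEq.refl _ _)
  · exact hW.ae_eq hZ (isWienerIntegral_wienerIntegral hZ le_rfl
      (memLp_indicator_Ioc_comp_sub (memLp_kernelE hK2 hR1) le_rfl le_rfl le_rfl σ))
  · filter_upwards [ae_sub_left (isCutoff_kernelE hK' hR').ae_eq u] with r hr
    by_cases hr0 : 0 < r
    · have h1 : ∫ s, R' (u - s) * κ s r = realConv R' K' (u - r) * σ := by
        simp only [κ, Set.indicator_of_mem (Set.mem_Ioi.2 hr0), ← mul_assoc]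
        rw [integral_mul_const]
        congr 1
        unfold realConv
        rw [← integral_sub_left_eq_self _ volume (u : ℝ)]
        refine integral_congr_ae (ae_of_all _ fun s => ?_)
        simp only [sub_sub_cancel]
        congr 2
        ring
      rw [h1]
      simp only [κ, Set.indicator_of_mem (Set.mem_Ioi.2 hr0)]
      by_cases hru : r ≤ u
      · have hmem : (u : ℝ) - r ∈ Set.Icc (0 : ℝ) u := ⟨by linarith, by linarith⟩
        rw [Set.indicator_of_mem (Set.mem_Ioc.2 ⟨hr0, hru⟩), ← hr hmem, Set.indicator_of_mem hmem]
        ring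
      · have h2 : realConv R' K' (u - r) = 0 := by
          refine integral_eq_zero_of_ae (ae_of_all _ fun s => ?_)
          by_cases hs : 0 ≤ s
          · simp [hK'.zero (u - r - s) fun h => hru (by linarith [h.1])]
          · simp [hR'.zero s fun h => hs h.1]
        rw [Set.indicator_of_notMem fun h => hru h.2, h2, hK'.zero _ fun h => hru (by linarith [h.1])]
        ring
    · have h1 (s : ℝ) : κ s r = 0 := Set.indicator_of_notMem (fun h => hr0 h) _
      simp [h1, hr0]

/-- A continuous solution of the affine Volterra equation is given by the variation of constants
formula. -/
lemma IsFOUSolution.isFOUExplicit (hZ : IsPreBrownianReal Z P) (hK : LpLoc K 2)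
    {p q : ℝ≥0∞} (hpq : p⁻¹ + q⁻¹ = 1) (hKp : LpLoc K p) (hμ : LpLoc μ q)
    (hF : ContinuousOn F (Set.Icc 0 T)) (hR : IsResolvent (fun t => K t * θ) R)
    (hX : IsFOUSolution P ℱ Z K μ F θ σ T X) : IsFOUExplicit P Z K μ F R θ σ T X := by
  intro u huT
  have huu : (u : ℝ) ∈ Set.Icc (0 : ℝ) u := ⟨u.2, le_rfl⟩
  obtain ⟨K', hK'⟩ := exists_isCutoff (hK u).1
  obtain ⟨R', hR'⟩ := exists_isCutoff (hR.loc u).1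
  obtain ⟨μ', hμ'⟩ := exists_isCutoff (hμ u).1
  have hFu : ContinuousOn F (Set.Icc 0 (u : ℝ)) := hF.mono (Set.Icc_subset_Icc_right huT)
  set F' : ℝ → ℝ := (Set.Icc 0 (u : ℝ)).indicator F with hF'_def
  have hF' : IsCutoff u F F' := isCutoff_of_continuousOn hFu
  set k : ℝ → ℝ := fun s => K' s * θ with hk_def
  have hk : IsCutoff u (fun s => K s * θ) k := hK'.mul_const θ
  have hρ : Integrable R' := memLp_one_iff_integrable.1 (hR'.memLp (hR.loc u))
  have hki : Integrable k := by
    refine memLp_one_iff_integrable.1 (hk.memLp ?_)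
    exact ((hK u).mono_exponent (by norm_num)).mul_const θ
  obtain ⟨x, hxm, hxb, hx0, hxX⟩ := exists_measurable_modification (P := P) (X := X) (u := u)
    (fun t ht => ((hX.adapted t ((NNReal.coe_le_coe.2 ht).trans huT)).mono (ℱ.le t)).aemeasurable)
    (hX.continuous.mono fun ω h => h.mono fun t ht => (NNReal.coe_le_coe.2 ht).trans huT)
  have hxω (ω : Ω) : Measurable fun s => x s ω := hxm.comp measurable_prodMk_right
  obtain ⟨C, hC⟩ := exists_integral_norm_mul_le hpq
    (hk.memLp ((hKp u).mul_const θ)) (hμ'.memLp (hμ u))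
  have hbdd {m : ℝ → ℝ} (hm : Measurable m) {B : ℝ} (hB : ∀ s, ‖m s‖ ≤ B) {f : ℝ → ℝ}
      (hf : Integrable f) (t : ℝ) : Integrable (fun s => f s * m (t - s)) ∧
        ∫ s, ‖f s * m (t - s)‖ ≤ (∫ s, ‖f s‖) * B := by
    have hi : Integrable (fun s => f s * m (t - s)) :=
      hf.mul_bdd (c := B) (hm.comp (measurable_const.sub measurable_id)).aestronglyMeasurable
        (ae_of_all _ fun s => hB _)
    refine ⟨hi, ?_⟩
    rw [← integral_mul_const]
    refine integral_mono hi.norm (hf.norm.mul_const B) fun s => ?_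
    simp only [norm_mul]
    exact mul_le_mul_of_nonneg_left (hB _) (norm_nonneg _)
  have hres : ∀ᵐ t : ℝ, t ∈ Set.Icc (0 : ℝ) u → realConv R' k t = k t - R' t := by
    filter_upwards [hR.right_eq, hk.ae_eq, hR'.ae_eq] with t h1 h2 h3 ht
    rw [h2 ht, h3 ht, ← h1 ht.1, ← hR'.intervalIntegral_eq hk ht]
    rfl
  obtain ⟨-, hμi, hμres⟩ := realConv_resolvent hρ hk.measurable hμ'.measurable hμ'.zero hC hres
  -- The equation solved for its stochastic term. This supplies a jointly measurable version of s ↦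
  -- M_s, which separate choices of Wiener integrals for each s would not.
  let N (s : ℝ) (ω : Ω) : ℝ := x s ω - F' s - realConv k μ' s + realConv k (fun r => x r ω) s
  have hNm : Measurable (Function.uncurry N) := by
    have h1 : Measurable (realConv k μ') := measurable_realConv (F := fun _ => k)
      (G := fun _ => μ') (hk.measurable.comp measurable_snd) (hμ'.measurable.comp measurable_snd)
      measurable_id
    have h2 : Measurable fun z : ℝ × Ω => realConv k (fun r => x r z.2) z.1 :=
      measurable_realConv (F := fun _ => k) (G := fun (z : ℝ × Ω) r => x r z.2)
        (hk.measurable.comp measurable_snd)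
        (hxm.comp (measurable_snd.prodMk (measurable_snd.comp measurable_fst))) measurable_fst
    exact ((hxm.sub (hF'.measurable.comp measurable_fst)).sub (h1.comp measurable_fst)).add h2
  have hNW (s : ℝ) (hs : s ∈ Set.Icc (0 : ℝ) u) :
      N s =ᵐ[P] wienerIntegral P Z 0 s (fun r => K (s - r) * σ) := by
    lift s to ℝ≥0 using hs.1
    filter_upwards [hX.equation s (hs.2.trans huT), hxX] with ω h1 h2
    obtain ⟨B, hB⟩ := hxb ω
    have hdiff : IsCutoff u (fun r => μ r - X r.toNNReal ω) (fun r => μ' r - x r ω) := by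
      refine ⟨hμ'.measurable.sub (hxω ω), fun r hr => by rw [hμ'.zero r hr, hx0 r hr, sub_zero], ?_⟩
      filter_upwards [hμ'.ae_eq] with r hr hru
      have h3 := h2 r.toNNReal (Real.toNNReal_le_iff_le_coe.2 hru.2)
      rw [Real.coe_toNNReal _ hru.1] at h3
      rw [hr hru, h3]
    have h_int : ∫ r in (0 : ℝ)..s, K (s - r) * (θ * (μ r - X r.toNNReal ω))
        = realConv k μ' s - realConv k (fun r => x r ω) s := by
      simp_rw [← mul_assoc]
      rw [hk.intervalIntegral_eq' hdiff hs]
      unfold realConv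
      rw [← integral_sub (hC s).1 (hbdd (hxω ω) hB hki s).1]
      simp_rw [mul_sub]
    have hFs : F' s = F s := Set.indicator_of_mem hs F
    rw [h_int, ← h2 s (NNReal.coe_le_coe.1 hs.2)] at h1
    simp only [N, hFs]
    linarith
  have hY := ae_eq_processY_of_wienerIntegral hZ (hK u) (hR.loc u) hK' hR' hNm hNW
  have hG : funG F R u = F u - realConv R' F' u := by
    rw [funG, hR'.intervalIntegral_eq' hF' huu]
  have hH : funH (kernelE K R) μ θ 0 u u = realConv R' μ' u := by
    rw [← hR'.intervalIntegral_eq' hμ' huu, funH]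
    refine intervalIntegral.integral_congr_ae ?_
    filter_upwards [ae_sub_left hR.kernelE_mul_ae_eq u] with s hs hsu
    rw [Set.uIoc_of_le u.coe_nonneg] at hsu
    rw [hs (sub_nonneg.2 hsu.2)]
  filter_upwards [hY, hxX] with ω h1 h2
  obtain ⟨B, hB⟩ := hxb ω
  obtain ⟨hxi, hkxi, hxres⟩ := realConv_resolvent hρ hk.measurable (hxω ω)
    (fun s hs => hx0 s hs ω) (hbdd (hxω ω) hB hki) hres
  obtain ⟨BF, hBF⟩ : ∃ B, ∀ s, ‖F' s‖ ≤ B := by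
    obtain ⟨B, hB⟩ := isCompact_Icc.exists_bound_of_continuousOn hFu
    refine ⟨B, fun s => ?_⟩
    by_cases hs : s ∈ Set.Icc 0 (u : ℝ)
    · rw [hF'_def, Set.indicator_of_mem hs]
      exact hB s hs
    · rw [hF'_def, Set.indicator_of_notMem hs, norm_zero]
      exact (norm_nonneg _).trans (hB u huu)
  have hFi := (hbdd hF'.measurable hBF hρ u).1
  have hsplit : ∫ s, R' (u - s) * N s ω = realConv R' (fun r => x r ω) u - realConv R' F' u
      - realConv R' (realConv k μ') u + realConv R' (realConv k fun r => x r ω) u := by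
    rw [← realConv_comm]
    unfold realConv at hkxi hμi ⊢
    have e1 := integral_sub hxi hFi
    have e2 := integral_sub (hxi.sub hFi) hμi
    have e3 := integral_add ((hxi.sub hFi).sub hμi) hkxi
    simp only [Pi.sub_apply] at e2 e3
    rw [← e1, ← e2, ← e3]
    refine integral_congr_ae (ae_of_all _ fun s => ?_)
    simp only [N, realConv]
    ring
  have hFu' : F' u = F u := Set.indicator_of_mem huu F
  have hNu : N u ω = X u ω - F u - realConv k μ' u + realConv k (fun r => x r ω) u := by
    simp only [N, h2 u le_rfl, hFu']
  -- After the resolvent identities, R⋆x and both k⋆μ and k⋆x cancel in N_u − (R⋆N)_u, leaving x_u −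
  -- F(u) + (R⋆F)(u) − (R⋆μ)(u).
  rw [hsplit, hμres, hxres, hNu] at h1
  rw [hG, hH, ← h1]
  have := h2 u le_rfl
  ring

end Solution

/-! ### The conditional moment generating function. -/

lemma integrable_exp_mul_of_map_eq_gaussianReal {Ω : Type*} {mΩ : MeasurableSpace Ω} {P : Measure Ω}
    {J : Ω → ℝ} {v : ℝ≥0} (hJ : AEMeasurable J P) (h : P.map J = gaussianReal 0 v) (w : ℝ) :
    Integrable (fun ω => Real.exp (w * J ω)) P := by
  have h1 := integrable_exp_mul_gaussianReal (μ := 0) (v := v) w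
  rw [← h] at h1
  exact h1.comp_aemeasurable hJ

/-- The conditional moment generating function of a Wiener integral. -/
lemma condExp_exp_mul_add_wienerIntegral {Ω : Type*} {mΩ : MeasurableSpace Ω} {P : Measure Ω}
    [IsProbabilityMeasure P] {ℱ : Filtration ℝ≥0 mΩ} {Z : ℝ≥0 → Ω → ℝ} (hZ : IsBrownianWrt Z ℱ P)
    {f : ℝ → ℝ} {J : Ω → ℝ} {t u : ℝ≥0} {A : Ω → ℝ}
    (hA : AEStronglyMeasurable[ℱ t] A P)
    (hJ : IsWienerIntegral P Z ((Set.Ioc (t : ℝ) u).indicator f) J) (w : ℝ)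
    (h_int : Integrable (fun ω => Real.exp (w * (A ω + J ω))) P) :
    P[fun ω => Real.exp (w * (A ω + J ω)) | ℱ t] =ᵐ[P] fun ω =>
      Real.exp (w * A ω + w ^ 2 * (1 / 2 * ∫ s in Set.Ioc (t : ℝ) u, f s ^ 2)) := by
  have hZ' := hZ.brownian.toIsPreBrownianReal
  have hJm := hJ.memLp_integral.1
  -- Independence concerns the σ-algebra generated by the variable, so a genuinely measurable
  -- version is needed.
  set J' : Ω → ℝ := hJm.mk J with hJ'_def
  have hJJ' : J =ᵐ[P] J' := hJm.ae_eq_mk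
  have hJ'm : Measurable J' := hJm.stronglyMeasurable_mk.measurable
  have hJ' := hJ.congr (EventuallyEq.refl _ _) hJJ'
  have hlaw := hJ'.map_eq hZ'
  have hexp : Integrable (fun ω => Real.exp (w * J' ω)) P :=
    integrable_exp_mul_of_map_eq_gaussianReal hJ'm.aemeasurable hlaw w
  have heq : (fun ω => Real.exp (w * (A ω + J ω)))
      =ᵐ[P] (fun ω => Real.exp (w * A ω)) * fun ω => Real.exp (w * J' ω) := by
    filter_upwards [hJJ'] with ω hω
    rw [Pi.mul_apply, ← Real.exp_add, hω, mul_add]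
  have hAexp : AEStronglyMeasurable[ℱ t] (fun ω => Real.exp (w * A ω)) P :=
    (by fun_prop : Continuous fun x : ℝ => Real.exp (w * x)).comp_aestronglyMeasurable hA
  have hindep : P[fun ω => Real.exp (w * J' ω) | ℱ t]
      =ᵐ[P] fun _ => ∫ ω, Real.exp (w * J' ω) ∂P := by
    refine condExp_indep_eq hJ'm.comap_le (ℱ.le t) ?_ (hJ'.indep hZ hJ'm)
    exact ((by fun_prop : Measurable fun x : ℝ => Real.exp (w * x)).comp
      (comap_measurable J')).stronglyMeasurable
  have hmgf : ∫ ω, Real.exp (w * J' ω) ∂P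
      = Real.exp (w ^ 2 * (1 / 2 * ∫ s in Set.Ioc (t : ℝ) u, f s ^ 2)) := by
    have h := mgf_gaussianReal hlaw w
    rw [mgf, Real.coe_toNNReal _ (integral_nonneg fun _ => sq_nonneg _)] at h
    rw [h]
    congr 1
    ring
  refine (condExp_congr_ae heq).trans ?_
  refine (condExp_mul_of_aestronglyMeasurable_left hAexp (h_int.congr heq) hexp).trans ?_
  filter_upwards [hindep] with ω hω
  rw [Pi.mul_apply, hω, hmgf, ← Real.exp_add]

theorem mainTheorem4 {Ω : Type*} {mΩ : MeasurableSpace Ω} (P : Measure Ω) [IsProbabilityMeasure P]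
    (ℱ : Filtration ℝ≥0 mΩ) (Z : ℝ≥0 → Ω → ℝ) (hZ : IsBrownianWrt Z ℱ P)
    (K μ F R : ℝ → ℝ) (θ σ T : ℝ) (hT : 0 < T)
    (hK : KernelRegular K)
    (p q : ℝ≥0∞) (hpq : p⁻¹ + q⁻¹ = 1) (hKp : LpLoc K p) (hμ : LpLoc μ q)
    (hF : ContinuousOn F (Set.Icc 0 T))
    (hR : IsResolvent (fun t => K t * θ) R)
    (X : ℝ≥0 → Ω → ℝ)
    (hX : IsFOUSolution P ℱ Z K μ F θ σ T X ∨ IsFOUExplicit P Z K μ F R θ σ T X)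
    (w : ℝ) (t u : ℝ≥0) (htu : t ≤ u) (huT : (u : ℝ) ≤ T) :
    Integrable (fun ω => Real.exp (w * X u ω)) P ∧
    P[fun ω => Real.exp (w * X u ω) | ℱ t] =ᵐ[P] fun ω =>
      Real.exp (w * (funG F R u + funH (kernelE K R) μ θ 0 u u
          + σ * processY P Z (kernelE K R) 1 0 t u ω)
        + w ^ 2 * funE (kernelE K R) σ t u) := by
  have hZ' := hZ.brownian.toIsPreBrownianReal
  have hexpl : IsFOUExplicit P Z K μ F R θ σ T X :=
    hX.elim (fun h => h.isFOUExplicit hZ' hK.sq_loc hpq hKp hμ hF hR) id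
  set E := kernelE K R with hE_def
  have hE : MemLp E 2 (volume.restrict (Set.Icc 0 (u : ℝ))) :=
    memLp_kernelE (hK.sq_loc u) (hR.loc u)
  have htu' : (t : ℝ) ≤ u := NNReal.coe_le_coe.2 htu
  have hW (c : ℝ) {a b : ℝ} (ha : 0 ≤ a) (hb : b ≤ u) := isWienerIntegral_wienerIntegral hZ' ha
    (memLp_indicator_Ioc_comp_sub hE ha hb le_rfl c)
  have h0u := hW σ le_rfl (le_refl (u : ℝ))
  have h0t := hW 1 le_rfl htu'
  have htu1 := hW σ t.coe_nonneg (le_refl (u : ℝ))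
  set J := wienerIntegral P Z t u fun s => E (u - s) * σ with hJ_def
  set c := funG F R u + funH E μ θ 0 u u with hc_def
  -- Additivity over (0,u] = (0,t] ∪ (t,u] holds only almost surely, by uniqueness of the Wiener
  -- integral.
  have hsum : (fun ω => σ * processY P Z E 1 0 t u ω + J ω) =ᵐ[P] processY P Z E σ 0 u u := by
    refine (((h0t.const_mul σ).add hZ' htu1).congr (ae_of_all _ fun s => ?_)
      (EventuallyEq.refl _ _)).ae_eq hZ' h0u
    have ht0 : (0 : ℝ) ≤ t := t.coe_nonneg
    rw [← Set.Ioc_union_Ioc_eq_Ioc ht0 htu']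
    by_cases h1 : s ∈ Set.Ioc 0 (t : ℝ)
    · have h2 : s ∉ Set.Ioc (t : ℝ) u := fun h => h.1.not_ge h1.2
      simp [h1, h2, mul_comm]
    · by_cases h2 : s ∈ Set.Ioc (t : ℝ) u <;> simp [h1, h2]
  have hXeq : X u =ᵐ[P] fun ω => (c + σ * processY P Z E 1 0 t u ω) + J ω := by
    filter_upwards [hexpl u huT, hsum] with ω h1 h2
    rw [h1, ← h2]
    ring
  have h_int : Integrable (fun ω => Real.exp (w * X u ω)) P := by
    -- The unsplit integral over (0,u] is Gaussian, so exponential integrability needs no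
    -- independence.
    have hlaw := IsWienerIntegral.map_eq hZ' (s := 0) (t := u) (by rwa [NNReal.coe_zero])
    refine ((integrable_exp_mul_of_map_eq_gaussianReal h0u.memLp_integral.1.aemeasurable
      hlaw w).const_mul (Real.exp (w * c))).congr ?_
    filter_upwards [hexpl u huT] with ω h1
    rw [h1, ← Real.exp_add, ← mul_add]
    rfl
  refine ⟨h_int, ?_⟩
  have hexpeq : (fun ω => Real.exp (w * X u ω))
      =ᵐ[P] fun ω => Real.exp (w * ((c + σ * processY P Z E 1 0 t u ω) + J ω)) := by
    filter_upwards [hXeq] with ω h1 using by rw [h1]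
  have hadapt : AEStronglyMeasurable[ℱ t] (fun ω => c + σ * processY P Z E 1 0 t u ω) P := by
    have h := IsWienerIntegral.aestronglyMeasurable hZ (s := 0) (t := t) (by rwa [NNReal.coe_zero])
    exact aestronglyMeasurable_const.add (h.const_mul σ)
  refine (condExp_congr_ae hexpeq).trans ((condExp_exp_mul_add_wienerIntegral hZ hadapt htu1 w
    (h_int.congr hexpeq)).trans (ae_of_all _ fun ω => ?_))
  have hvar : ∫ s in Set.Ioc (t : ℝ) u, (E (u - s) * σ) ^ 2
      = σ ^ 2 * ∫ s in (t : ℝ)..u, E (u - s) ^ 2 := by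
    rw [intervalIntegral.integral_of_le htu', ← integral_const_mul]
    simp only [mul_pow, mul_comm]
  simp only [hvar, funE]
  congr 2
  ring
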